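/- All graphs are finite and simple. The order of a graph is its number of vertices, its size the number of its edges. A graph is traceable if it has a hamiltonian path, and nontraceable otherwise; it is claw-free if it has no induced subgraph isomorphic to $K_{1,3}$; it is 2-connected if it is connected, has at least three vertices, and has no cut-vertex (a vertex $v$ such that $G-v$ has more components than $G$). The detour order of a vertex $v$ is the number of vertices of a longest path starting at $v$; a detour graph is a graph in which all vertices have the same detour order; a CND graph is a connected, nontraceable, detour graph. Let $A$ and $B$ be the following graphs with vertex set $\{0,1,\dots,17\}$. Both contain the cycle $0,1,\dots,15,0$ and the four edges $\{15,1\},\{3,5\},\{7,9\},\{11,13\}$. In addition, $A$ has the edges $\{16,0\},\{16,8\},\{17,4\},\{17,12\}$, and $B$ has the edges $\{16,0\},\{16,4\},\{17,8\},\{17,12\}$. **Theorem.** 1. Every 2-connected, claw-free, nontraceable graph $G$ has order at least $18$. If its order is $18$, then its size is at least $24$, and its size is $24$ if and only if $G$ is isomorphic to $A$ or to $B$. 2. $A$ and $B$ are 2-connected, claw-free, nontraceable graphs of size $24$, and they are not isomorphic. Hence $24$ is the least size of such a graph of order $18$, and up to isomorphism it is attained exactly by the two graphs $A$ and $B$.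 3. For a loopless cubic multigraph $L$, consider the graph obtained from $L$ by replacing each vertex $v$ with a triangle, whose three vertices are made incident with the three edges at $v$, one each, and then subdividing each (former) edge of $L$ by one new vertex. $A$ is isomorphic to the graph so obtained from $L=K_4$, and $B$ to the one so obtained from $L=C_2\times K_2$ (the multigraph with vertices $0,1,2,3$, two edges $\{0,1\}$, two edges $\{2,3\}$, and edges $\{0,2\}$ and $\{1,3\}$). 4. $A$ and $B$ are CND graphs, and they are the smallest claw-free CND graphs: every claw-free CND graph has order at least $18$; if its order is $18$, then its size is at least $24$, with equality if and only if it is isomorphic to $A$ or to $B$. -/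

import Mathlib

namespace SimpleGraph

/-- A graph is traceable if it has a hamiltonian path, i.e. a path containing all the vertices. -/
def Traceable {V : Type*} (G : SimpleGraph V) : Prop :=
  ∃ (u v : V) (p : G.Walk u v), p.IsPath ∧ ∀ w : V, w ∈ p.support

/-- `v` is a cut-vertex of `G` if `G - v` has more components than `G`. -/
def IsCutVertex {V : Type*} (G : SimpleGraph V) (v : V) : Prop :=
  Nat.card G.ConnectedComponent < Nat.card (G.induce {w : V | w ≠ v}).ConnectedComponent

/-- `G` is 2-connected if it is connected, has at least three vertices and no cut-vertex. -/
def TwoConnected {V : Type*} (G : SimpleGraph V) : Prop :=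
  G.Connected ∧ 3 ≤ Nat.card V ∧ ∀ v : V, ¬ G.IsCutVertex v

/-- `G` is claw-free if it has no induced subgraph isomorphic to the claw `K_{1,3}`. -/
def ClawFree {V : Type*} (G : SimpleGraph V) : Prop :=
  ¬ (completeBipartiteGraph (Fin 1) (Fin 3)).IsIndContained G

/-- The detour order of `v`: the largest number of vertices of a path with initial vertex `v`
(the set is non-empty, and bounded above when `V` is finite). -/
noncomputable def detourOrder {V : Type*} (G : SimpleGraph V) (v : V) : ℕ :=
  sSup {n : ℕ | ∃ (w : V) (p : G.Walk v w), p.IsPath ∧ n = p.length + 1}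

/-- A detour graph: its detour sequence is constant, i.e. all vertices have the same
detour order. -/
def IsDetourGraph {V : Type*} (G : SimpleGraph V) : Prop :=
  ∀ u v : V, G.detourOrder u = G.detourOrder v

/-- A CND graph: a connected, nontraceable, detour graph. -/
def IsCND {V : Type*} (G : SimpleGraph V) : Prop :=
  G.Connected ∧ ¬ G.Traceable ∧ G.IsDetourGraph

/-- Let `ends` describe a multigraph with vertex set `V` and edge set `E` (the edge `e` joins
`ends e 0` to `ends e 1`).  Inflate each vertex `v` with a complete graph on `deg v` vertices and
insert a `K_1` in each edge.  The vertices `Sum.inl (e, i)` are those of the complete graphs: the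
`i`-th end of `e`, lying in the complete graph that replaces the vertex `ends e i`.
The vertex `Sum.inr e` is the one inserted in the edge `e`. -/
def inflateInsert {V E : Type*} (ends : E → Fin 2 → V) : SimpleGraph ((E × Fin 2) ⊕ E) :=
  SimpleGraph.fromRel fun x y => match x, y with
    | Sum.inl a, Sum.inl b => ends a.1 a.2 = ends b.1 b.2
    | Sum.inl a, Sum.inr e => a.1 = e
    | Sum.inr _, _ => False

/-- The six edges of the complete graph `K_4` on `{0, 1, 2, 3}`. -/
def endsK4 : Fin 6 → Fin 2 → Fin 4 :=
  ![![0, 1], ![0, 2], ![0, 3], ![1, 2], ![1, 3], ![2, 3]]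

/-- The six edges of the multigraph `C_2 × K_2`: two copies `{0, 1}` and `{2, 3}` of the cycle
`C_2` (a double edge), with corresponding vertices joined. -/
def endsC2K2 : Fin 6 → Fin 2 → Fin 4 :=
  ![![0, 1], ![0, 1], ![2, 3], ![2, 3], ![0, 2], ![1, 3]]

/-- The graph on `18` vertices made of the cycle `0, 1, …, 15, 0`, the four chords joining the two
cycle-neighbours of each of `0, 4, 8, 12`, and the further edges listed in `l`. -/
def cycleWithBridges (l : List (Fin 18 × Fin 18)) : SimpleGraph (Fin 18) :=
  SimpleGraph.fromRel fun x y =>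
    (x.val < 16 ∧ y.val = (x.val + 1) % 16) ∨
    (x, y) ∈ ([(15, 1), (3, 5), (7, 9), (11, 13)] : List (Fin 18 × Fin 18)) ∨
    (x, y) ∈ l

/-- Graph `A`: the pairs `{0, 8}` and `{4, 12}`, crossed on the 16-cycle, are joined to the
vertices `16` and `17` respectively. -/
def graphA : SimpleGraph (Fin 18) :=
  cycleWithBridges [(16, 0), (16, 8), (17, 4), (17, 12)]

/-- Graph `B`: the pairs `{0, 4}` and `{8, 12}`, not crossed on the 16-cycle, are joined to the
vertices `16` and `17` respectively. -/
def graphB : SimpleGraph (Fin 18) :=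
  cycleWithBridges [(16, 0), (16, 4), (17, 8), (17, 12)]

end SimpleGraph

/-! Take a longest cycle, with `c` vertices, in a 2-connected, claw-free, nontraceable graph of
order at most 18. If a vertex of the cycle has a neighbour off the cycle, then claw-freeness and
maximality make its two cycle-neighbours adjacent. These chords allow the cycle to be rerouted near
every attachment. Two consequences carry the proof. An ear (a path off the cycle joined at its ends
to two cycle vertices) with `k` vertices has its attachments at distance at least `k + 3` along both
arcs (`gap_of_ear`), so `c ≥ 2k + 6`. And an interval of at most four vertices whose ends are
attachments can be covered by two disjoint paths, one leading from each side of the interval to one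
attachment (`Split`); ears can then be spliced into new cycles and paths that lose no vertex.

By 2-connectedness, any nonempty union of components off the cycle contains an ear. If a longest
such ear has a further neighbour off the cycle, it has at least four vertices
(`isClosedOff_or_four_le`), and then at least `14 + 4 + 1 = 19` vertices are needed. So the vertices
off the cycle are used up by disjoint isolated ears, with distinct attachments.

No ear, or one, gives a hamiltonian path at once. Four ears force `c ≤ 14` and three force `c ≤ 15`;
a finite check over the positions of the attachments shows that splicing gives a longer cycle or,
when exactly three ears cover everything, possibly a hamiltonian path instead. For exactly two ears,
attachments of different ears at distance at most 3 would give a hamiltonian path, so the four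
attachments are pairwise at distance at least 4. Hence `c ≥ 16`, and `c + 2 ≤ 18` makes everything
tight: the order is 18, both ears are single vertices, and the attachments are 0, 4, 8, 12. The
cycle, four chords and four ear edges form a spanning `graphA` (crossed pairs) or `graphB`
(uncrossed pairs) with 24 edges, which yields the bounds and the equality case.

A CND graph is 2-connected: apart from `v`, a longest path from a cut-vertex `v` stays in one
component of `G - v`, and a neighbour of `v` in another component can be put in front of it. The
stated properties of `graphA` and `graphB` are finite computations. -/

namespace SimpleGraph

/-! ### Walks as vertex lists, and the use of 2-connectedness -/

variable {V : Type*} {G : SimpleGraph V}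

/-- The list `l` is the list of successive vertices of a walk from `a` to `b`. -/
def WalkList (G : SimpleGraph V) (a b : V) (l : List V) : Prop :=
  l.IsChain G.Adj ∧ l.head? = some a ∧ l.getLast? = some b

namespace WalkList

theorem ne_nil {a b : V} {l : List V} (h : G.WalkList a b l) : l ≠ [] := by
  rintro rfl
  simp [WalkList] at h

theorem single (a : V) : G.WalkList a a [a] := by simp [WalkList]

theorem head_mem {a b : V} {l : List V} (h : G.WalkList a b l) : a ∈ l :=
  List.mem_of_head? h.2.1

theorem last_mem {a b : V} {l : List V} (h : G.WalkList a b l) : b ∈ l :=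
  List.mem_of_getLast? h.2.2

theorem append {a b c d : V} {l m : List V} (h : G.WalkList a b l) (hbc : G.Adj b c)
    (h' : G.WalkList c d m) : G.WalkList a d (l ++ m) := by
  obtain ⟨h1, h2, h3⟩ := h
  obtain ⟨h1', h2', h3'⟩ := h'
  refine ⟨List.isChain_append.2 ⟨h1, h1', ?_⟩, ?_, ?_⟩
  · simp_all
  · simp [List.head?_append, h2]
  · simp [List.getLast?_append, h3']

theorem cons {a b c : V} {l : List V} (hab : G.Adj a b) (h : G.WalkList b c l) :
    G.WalkList a c (a :: l) :=
  (single a).append hab h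

theorem reverse {a b : V} {l : List V} (h : G.WalkList a b l) : G.WalkList b a l.reverse := by
  obtain ⟨h1, h2, h3⟩ := h
  refine ⟨?_, by simpa using h3, by simpa using h2⟩
  rw [List.isChain_reverse]
  exact h1.imp fun _ _ h => h.symm

theorem pair {a b : V} (h : G.Adj a b) : G.WalkList a b [a, b] := (single b).cons h

theorem length_pos {a b : V} {l : List V} (h : G.WalkList a b l) : 1 ≤ l.length :=
  List.length_pos_of_ne_nil h.ne_nil

theorem eq_cons {a b : V} {l : List V} (h : G.WalkList a b l) : ∃ l', l = a :: l' := by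
  obtain ⟨-, h2, -⟩ := h
  cases l with
  | nil => simp at h2
  | cons x l => simp at h2; exact ⟨l, by rw [h2]⟩

theorem exists_walk {a b : V} {l : List V} (h : G.WalkList a b l) :
    ∃ p : G.Walk a b, p.support = l := by
  have ha : l.head h.ne_nil = a := by
    have := h.2.1
    rw [List.head?_eq_some_head h.ne_nil] at this
    exact Option.some.inj this
  have hb : l.getLast h.ne_nil = b := by
    have := h.2.2
    rw [List.getLast?_eq_some_getLast h.ne_nil] at this
    exact Option.some.inj this
  exact ⟨(Walk.ofSupport l h.ne_nil h.1).copy ha hb, by simp⟩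

theorem traceable {a b : V} {l : List V} (h : G.WalkList a b l) (hn : l.Nodup)
    (hl : ∀ v, v ∈ l) : G.Traceable := by
  obtain ⟨p, rfl⟩ := h.exists_walk
  exact ⟨a, b, p, Walk.IsPath.mk' hn, hl⟩

end WalkList

theorem Walk.walkList_support {a b : V} (p : G.Walk a b) : G.WalkList a b p.support :=
  ⟨p.isChain_adj_support, by cases p <;> simp, by
    rw [List.getLast?_eq_some_getLast p.support_ne_nil, p.getLast_support]⟩

/-- The form in which claw-freeness is used throughout: otherwise `v, x, y, z` would induce a claw
centred at `v`. -/
theorem ClawFree.adj_of_adj (hG : G.ClawFree) {v x y z : V} (hx : G.Adj v x) (hy : G.Adj v y)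
    (hz : G.Adj v z) (hxy : x ≠ y) (hxz : x ≠ z) (hyz : y ≠ z) :
    G.Adj x y ∨ G.Adj x z ∨ G.Adj y z := by
  by_contra! h
  obtain ⟨h1, h2, h3⟩ := h
  apply hG
  have h1' := fun h => h1 (G.adj_symm h)
  have h2' := fun h => h2 (G.adj_symm h)
  have h3' := fun h => h3 (G.adj_symm h)
  refine ⟨⟨⟨Sum.elim (fun _ => v) ![x, y, z], ?_⟩, ?_⟩⟩
  · rintro (a | a) (b | b) hab
    · simp [Subsingleton.elim a b]
    · fin_cases b <;> simp at hab
      · exact absurd hab hx.ne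
      · exact absurd hab hy.ne
      · exact absurd hab hz.ne
    · fin_cases a <;> simp at hab
      · exact absurd hab.symm hx.ne
      · exact absurd hab.symm hy.ne
      · exact absurd hab.symm hz.ne
    · fin_cases a <;> fin_cases b <;> simp_all
  · intro a b
    change G.Adj (Sum.elim (fun _ => v) ![x, y, z] a) (Sum.elim (fun _ => v) ![x, y, z] b) ↔ _
    rcases a with a | a <;> rcases b with b | b
    · simp
    · fin_cases b <;> simp [hx, hy, hz]
    · fin_cases a <;> simp [hx.symm, hy.symm, hz.symm]
    · fin_cases a <;> fin_cases b <;> simp_all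

/-- Connectedness after the removal of a vertex, in the form in which it is used to find paths. -/
theorem TwoConnected.induce_connected [Finite V] (hG : G.TwoConnected) (v : V) :
    (G.induce {w : V | w ≠ v}).Connected := by
  obtain ⟨hc, h3, hcut⟩ := hG
  have hv := hcut v
  unfold IsCutVertex at hv
  have h1 : Nat.card G.ConnectedComponent = 1 := by
    have := hc.preconnected.subsingleton_connectedComponent
    have := hc.nonempty
    rw [Nat.card_eq_one_iff_unique]
    exact ⟨inferInstance, inferInstance⟩
  rw [h1] at hv
  obtain ⟨w, hw⟩ : ∃ w, w ≠ v := by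
    have : Nontrivial V := by
      rw [← Finite.one_lt_card_iff_nontrivial]; omega
    exact exists_ne v
  have : Nonempty {w : V | w ≠ v} := ⟨⟨w, hw⟩⟩
  have hs : Subsingleton (G.induce {w : V | w ≠ v}).ConnectedComponent := by
    rw [← Finite.card_le_one_iff_subsingleton]; omega
  refine ⟨fun a b => ?_⟩
  exact ConnectedComponent.exact (Subsingleton.elim _ _)

theorem twoConnected_of_induce_connected [Finite V] (hG : G.Connected) (h3 : 3 ≤ Nat.card V)
    (h : ∀ v, (G.induce {w : V | w ≠ v}).Connected) : G.TwoConnected := by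
  refine ⟨hG, h3, fun v hv => ?_⟩
  unfold IsCutVertex at hv
  have h1 : Nat.card (G.induce {w : V | w ≠ v}).ConnectedComponent ≤ 1 := by
    have := (h v).preconnected.subsingleton_connectedComponent
    exact Finite.card_le_one_iff_subsingleton.2 this
  have h2 : 0 < Nat.card G.ConnectedComponent := by
    have := hG.nonempty
    exact Nat.card_pos
  omega

/-- A path from `y` towards a set `T`, cut off just before it enters `T`. -/
theorem Walk.exists_walkList_to_set {T : Set V} {y t : V} (w : G.Walk y t) (hw : w.IsPath)
    (hy : y ∉ T) (ht : t ∈ T) :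
    ∃ Q z s, G.WalkList y z Q ∧ Q.Nodup ∧ (∀ q ∈ Q, q ∉ T) ∧ (∀ q ∈ Q, q ∈ w.support) ∧
      s ∈ T ∧ s ∈ w.support ∧ G.Adj z s := by
  induction w with
  | nil => exact absurd ht hy
  | @cons a b c hab w ih =>
    rw [Walk.cons_isPath_iff] at hw
    by_cases hb : b ∈ T
    · exact ⟨[a], a, b, .single a, by simp, by simpa using hy, by simp, hb, by simp, hab⟩
    · obtain ⟨Q, z, s, h1, h2, h3, h4, h5, h6, h7⟩ := ih hw.1 hb ht
      refine ⟨a :: Q, z, s, h1.cons hab, ?_, ?_, ?_, h5, ?_, h7⟩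
      · exact List.nodup_cons.2 ⟨fun h => hw.2 (h4 a h), h2⟩
      · rintro q hq
        rcases List.mem_cons.1 hq with rfl | hq
        · exact hy
        · exact h3 q hq
      · rintro q hq
        rcases List.mem_cons.1 hq with rfl | hq
        · simp
        · simp [h4 q hq]
      · simp [h6]

/-- Since `G - p` is connected, it contains a path from `y` to `t`, which is cut off where it first
meets `T`. All cycles and ears are built from such paths. -/
theorem TwoConnected.exists_walkList_to_set [Finite V] (hG : G.TwoConnected) {T : Set V}
    {y t p : V} (hy : y ∉ T) (hyp : y ≠ p) (ht : t ∈ T) (htp : t ≠ p) :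
    ∃ Q z s, G.WalkList y z Q ∧ Q.Nodup ∧ (∀ q ∈ Q, q ∉ T) ∧ (∀ q ∈ Q, q ≠ p) ∧
      s ∈ T ∧ s ≠ p ∧ G.Adj z s := by
  classical
  obtain ⟨w⟩ := (hG.induce_connected p).preconnected ⟨y, hyp⟩ ⟨t, htp⟩
  let w' := (w.map (Embedding.induce {w : V | w ≠ p}).toHom)
  have hw' : ∀ q ∈ w'.support, q ≠ p := by
    intro q hq
    simp only [w', Walk.support_map, List.mem_map] at hq
    obtain ⟨x, -, rfl⟩ := hq
    exact x.2
  obtain ⟨Q, z, s, h1, h2, h3, h4, h5, h6, h7⟩ :=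
    w'.bypass.exists_walkList_to_set w'.bypass_isPath hy ht
  exact ⟨Q, z, s, h1, h2, h3, fun q hq => hw' q (w'.support_bypass_subset_support (h4 q hq)), h5,
    hw' s (w'.support_bypass_subset_support h6), h7⟩

/-- The list `l` is the cyclic list of vertices of a cycle. -/
def CycleList (G : SimpleGraph V) (l : List V) : Prop :=
  (∃ a b, G.WalkList a b l ∧ G.Adj b a) ∧ l.Nodup ∧ 3 ≤ l.length

theorem TwoConnected.exists_cycleList [Finite V] (hG : G.TwoConnected) :
    ∃ l, G.CycleList l := by
  obtain ⟨hc, h3, -⟩ := id hG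
  have hn : Nontrivial V := by
    rw [← Finite.one_lt_card_iff_nontrivial]; omega
  obtain ⟨x⟩ := hc.nonempty
  obtain ⟨y, hxy⟩ := hc.preconnected.exists_adj_of_nontrivial x
  obtain ⟨z, hz⟩ : ∃ z, z ∉ ({x, y} : Set V) := by
    by_contra! h
    have : Set.ncard (Set.univ : Set V) ≤ Set.ncard ({x, y} : Set V) :=
      Set.ncard_le_ncard (fun z _ => h z)
    rw [Set.ncard_univ] at this
    have := Set.ncard_insert_le x {y}
    rw [Set.ncard_singleton] at this
    omega
  obtain ⟨w⟩ := hc.preconnected z x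
  classical
  obtain ⟨Q, q, t, h1, h2, h3, h4, h5, h6, h7⟩ :=
    w.bypass.exists_walkList_to_set w.bypass_isPath hz (by simp : x ∈ ({x, y} : Set V))
  -- A vertex `t` with two distinct neighbours `q` and `s` lies on a cycle: a path from `q` to `s`
  -- in `G - t` closes up through `t`. One of `x`, `y` is such a vertex, having the other one and
  -- `q` as neighbours.
  have key : ∀ t s, G.Adj t s → G.Adj t q → q ≠ s → ∃ l, G.CycleList l := by
    intro t s hts htq hqs
    obtain ⟨Q, z, r, h1, h2, h3, h4, h5, -, h7⟩ :=
      hG.exists_walkList_to_set (T := {s}) (y := q) (p := t) (by simpa using hqs) htq.ne'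
        rfl hts.ne'
    obtain rfl : r = s := h5
    refine ⟨t :: Q ++ [r], ⟨t, r, (h1.cons htq).append h7 (.single r), hts.symm⟩, ?_, ?_⟩
    · simp only [List.cons_append, List.nodup_cons, List.mem_append, List.mem_singleton]
      refine ⟨?_, ?_⟩
      · rintro (h | h)
        · exact h4 t h rfl
        · exact hts.ne h
      · rw [List.nodup_append]
        refine ⟨h2, by simp, ?_⟩
        rintro a ha b hb rfl
        exact h3 a ha (by simpa using hb)
    · have := h1.length_pos
      simp; omega
  have hq := h3 q h1.last_mem
  simp only [Set.mem_insert_iff, Set.mem_singleton_iff, not_or] at hq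
  rcases h5 with rfl | h5
  · exact key t y hxy h7.symm hq.2
  · obtain rfl : t = y := h5
    exact key t x hxy.symm h7.symm hq.1

end SimpleGraph

/-! ### Longest cycles, their attachments, and the gap between the ends of an ear -/

namespace SimpleGraph

variable {V : Type*} {G : SimpleGraph V}

/-- The function `f` runs periodically around a longest cycle, which has `c` vertices. -/
structure IsLongestCycle (G : SimpleGraph V) (f : ℤ → V) (c : ℕ) : Prop where
  three_le : 3 ≤ c
  periodic : ∀ i, f (i + c) = f i
  dvd_of_eq : ∀ i j, f i = f j → (c : ℤ) ∣ j - i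
  adj : ∀ i, G.Adj (f i) (f (i + 1))
  max : ∀ l, G.CycleList l → l.length ≤ c

theorem exists_isLongestCycle [Finite V] (h : ∃ l, G.CycleList l) :
    ∃ f c, G.IsLongestCycle f c := by
  classical
  cases nonempty_fintype V
  have hb : ∃ n, ∀ l, G.CycleList l → l.length ≤ n :=
    ⟨Fintype.card V, fun l hl => hl.2.1.length_le_card⟩
  obtain ⟨l, hl, hmax⟩ : ∃ l, G.CycleList l ∧ ∀ m, G.CycleList m → m.length ≤ l.length := by
    obtain ⟨n, hn⟩ := hb
    let P : ℕ → Prop := fun k => ∃ l, G.CycleList l ∧ l.length = k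
    obtain ⟨l₀, hl₀⟩ := h
    have h1 : P (Nat.findGreatest P n) :=
      Nat.findGreatest_spec (P := P) (hn l₀ hl₀) ⟨l₀, hl₀, rfl⟩
    obtain ⟨l, hl, hk⟩ := h1
    exact ⟨l, hl, fun m hm => hk ▸ Nat.le_findGreatest (hn m hm) ⟨m, hm, rfl⟩⟩
  obtain ⟨⟨a, b, hw, hba⟩, hnd, h3⟩ := id hl
  have hc : (0 : ℤ) < l.length := by omega
  have hlt : ∀ i : ℤ, (i % l.length).toNat < l.length := fun i => by
    have := Int.emod_nonneg i hc.ne'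
    have := Int.emod_lt_of_pos i hc
    omega
  -- Indices are integers read modulo the length, so that rotating the cycle is a translation.
  refine ⟨fun i => l[(i % l.length).toNat]'(hlt i), l.length, h3, ?_, ?_, ?_, hmax⟩
  · intro i
    simp
  · intro i j hij
    have h1 := (hnd.getElem_inj_iff).1 hij
    have := Int.emod_nonneg i hc.ne'
    have := Int.emod_nonneg j hc.ne'
    have h2 : i % l.length = j % l.length := by omega
    exact Int.ModEq.dvd h2
  · intro i
    have h0 := Int.emod_nonneg i hc.ne'
    have h1 := Int.emod_lt_of_pos i hc
    obtain ⟨k, hk⟩ : ∃ k : ℕ, i % l.length = k := ⟨_, (Int.toNat_of_nonneg h0).symm⟩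
    by_cases hlast : k + 1 = l.length
    · have h2 : (i + 1) % l.length = 0 := by
        rw [Int.add_emod, hk]
        have : ((1 : ℤ) % l.length) = 1 := Int.emod_eq_of_lt (by omega) (by omega)
        rw [this]
        have : ((k : ℤ) + 1) = l.length := by exact_mod_cast hlast
        rw [this, Int.emod_self]
      simp only [h2, hk]
      have hb : l[k]'(by omega) = b := by
        have := hw.2.2
        rw [List.getLast?_eq_getElem?, ← hlast, List.getElem?_eq_getElem (by omega)] at this
        simpa using this
      have ha : l[0]'(by omega) = a := by
        have := hw.2.1
        rw [List.head?_eq_getElem?, List.getElem?_eq_getElem (by omega)] at this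
        simpa using this
      simpa [hb, ha] using hba
    · have h2 : (i + 1) % l.length = k + 1 := by
        rw [Int.add_emod, hk]
        have : ((1 : ℤ) % l.length) = 1 := Int.emod_eq_of_lt (by omega) (by omega)
        rw [this]
        exact Int.emod_eq_of_lt (by omega) (by omega)
      have h3 : ((k : ℤ) + 1).toNat = k + 1 := by omega
      simp only [h2, hk, h3, Int.toNat_natCast]
      exact List.isChain_iff_getElem.1 hw.1 k (by omega)

/-- The successive vertices `f i, …, f (i + n - 1)`. -/
def seg (f : ℤ → V) (i : ℤ) (n : ℕ) : List V := (List.range n).map fun t : ℕ => f (i + t)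

@[simp] theorem length_seg (f : ℤ → V) (i : ℤ) (n : ℕ) : (seg f i n).length = n := by
  simp [seg]

theorem seg_add (f : ℤ → V) (i : ℤ) (m n : ℕ) :
    seg f i (m + n) = seg f i m ++ seg f (i + m) n := by
  simp [seg, List.range_add, add_assoc]

theorem seg_one (f : ℤ → V) (i : ℤ) : seg f i 1 = [f i] := by simp [seg]

theorem mem_seg {f : ℤ → V} {i : ℤ} {n : ℕ} {v : V} :
    v ∈ seg f i n ↔ ∃ t : ℕ, t < n ∧ f (i + t) = v := by
  simp [seg]

/-- A path `D` outside the range of `f`, together with the vertices `u` and `v` to which its ends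
are joined. -/
def Ear (G : SimpleGraph V) (f : ℤ → V) (D : List V) (u v : V) : Prop :=
  (∃ a b, G.WalkList a b D ∧ G.Adj u a ∧ G.Adj b v) ∧ D.Nodup ∧ ∀ x ∈ D, x ∉ Set.range f

theorem Ear.reverse {f : ℤ → V} {D : List V} {u v : V} (h : G.Ear f D u v) :
    G.Ear f D.reverse v u := by
  obtain ⟨⟨a, b, h1, h2, h3⟩, h4, h5⟩ := h
  exact ⟨⟨b, a, h1.reverse, h3.symm, h2.symm⟩, by simpa using h4, by simpa using h5⟩

theorem Ear.length_pos {f : ℤ → V} {D : List V} {u v : V} (h : G.Ear f D u v) :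
    1 ≤ D.length := by
  obtain ⟨⟨a, b, h1, h2, h3⟩, h4, h5⟩ := h
  exact h1.length_pos

/-- The vertices `f s, …, f (s + n - 1)` are split into two paths, one leading from the vertex
before them to `x`, and one from `y` to the vertex after them. -/
def Split (G : SimpleGraph V) (f : ℤ → V) (s : ℤ) (n : ℕ) (x y : V) : Prop :=
  ∃ X Y x₀ y₀, G.WalkList x₀ x X ∧ G.WalkList y y₀ Y ∧ G.Adj (f (s - 1)) x₀ ∧
    G.Adj y₀ (f (s + n)) ∧ (X ++ Y).Perm (seg f s n)

theorem walkList_seg {f : ℤ → V} (hf : ∀ i, G.Adj (f i) (f (i + 1))) (i : ℤ) {n : ℕ}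
    (hn : 1 ≤ n) : G.WalkList (f i) (f (i + n - 1)) (seg f i n) := by
  induction n, hn using Nat.le_induction with
  | base => simpa [seg_one] using WalkList.single (f i)
  | succ n hn ih =>
    rw [seg_add, seg_one]
    have := hf (i + n - 1)
    rw [sub_add_cancel] at this
    have h := ih.append this (WalkList.single _)
    have e : i + ((n + 1 : ℕ) : ℤ) - 1 = i + n := by push_cast; ring
    rwa [e]

namespace IsLongestCycle

variable {f : ℤ → V} {c : ℕ}

theorem shift (h : G.IsLongestCycle f c) (k : ℤ) : G.IsLongestCycle (fun i => f (i + k)) c where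
  three_le := h.three_le
  periodic i := by rw [← h.periodic (i + k)]; congr 1; ring
  dvd_of_eq i j hij := by simpa using h.dvd_of_eq _ _ hij
  adj i := by have := h.adj (i + k); rwa [add_right_comm] at this
  max := h.max

theorem eq_of_dvd (h : G.IsLongestCycle f c) {i j : ℤ} (hij : (c : ℤ) ∣ j - i) : f i = f j := by
  obtain ⟨k, hk⟩ := hij
  obtain rfl : j = i + c * k := by omega
  induction k using Int.induction_on generalizing i with
  | zero => simp
  | succ n ih =>
    rw [mul_add, mul_one, ← add_assoc, h.periodic]
    exact ih (by ring)
  | pred n ih =>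
    rw [← h.periodic (i + c * (-n - 1))]
    have e : i + c * (-(n : ℤ) - 1) + c = i + c * -n := by ring
    rw [e]
    exact ih (by ring)

theorem nodup_seg (h : G.IsLongestCycle f c) (i : ℤ) {n : ℕ} (hn : n ≤ c) :
    (seg f i n).Nodup := by
  refine List.Nodup.map_on ?_ List.nodup_range
  intro a ha b hb hab
  rw [List.mem_range] at ha hb
  have := h.dvd_of_eq _ _ hab
  have h2 := Int.eq_zero_of_abs_lt_dvd this (by rw [abs_lt]; omega)
  omega

theorem mem_seg_iff (h : G.IsLongestCycle f c) (i : ℤ) (v : V) :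
    v ∈ seg f i c ↔ v ∈ Set.range f := by
  rw [mem_seg]
  refine ⟨fun ⟨t, _, ht⟩ => ⟨_, ht⟩, ?_⟩
  rintro ⟨j, rfl⟩
  have hc : (0 : ℤ) < c := by have := h.three_le; omega
  have h1 := Int.emod_nonneg (j - i) hc.ne'
  have h2 := Int.emod_lt_of_pos (j - i) hc
  refine ⟨((j - i) % c).toNat, by omega, ?_⟩
  apply h.eq_of_dvd
  rw [Int.toNat_of_nonneg h1]
  have := Int.emod_def (j - i) c
  refine ⟨(j - i) / c, ?_⟩
  linarith

theorem false_of_walkList (h : G.IsLongestCycle f c) {a b : V} {l : List V}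
    (hl : G.WalkList a b l) (hab : G.Adj b a) (hn : l.Nodup) (hc : c < l.length) : False := by
  have := h.max l ⟨⟨a, b, hl, hab⟩, hn, by have := h.three_le; omega⟩
  omega

theorem nodup_append (h : G.IsLongestCycle f c) (i : ℤ) {n : ℕ} (hn : n ≤ c) {D : List V}
    (hD : D.Nodup) (hDf : ∀ x ∈ D, x ∉ Set.range f) : (seg f i n ++ D).Nodup := by
  rw [List.nodup_append]
  refine ⟨h.nodup_seg i hn, hD, ?_⟩
  rintro a ha b hb rfl
  obtain ⟨t, -, rfl⟩ := mem_seg.1 ha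
  exact hDf _ hb ⟨_, rfl⟩

/-- Otherwise `d` could be inserted between two consecutive vertices of the cycle. -/
theorem not_adj_succ (h : G.IsLongestCycle f c) {j : ℤ} {d : V} (hd : d ∉ Set.range f)
    (h1 : G.Adj d (f j)) : ¬ G.Adj d (f (j + 1)) := by
  intro h2
  have hc := h.three_le
  have hw := (walkList_seg h.adj (j + 1) (n := c) (by omega)).append (c := d) (d := d)
    (by
      have e : j + 1 + (c : ℤ) - 1 = j + c := by ring
      rw [e, h.periodic]; exact h1.symm) (.single d)
  exact h.false_of_walkList hw h2 (h.nodup_append _ le_rfl (by simp) (by simpa using hd))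
    (by simp)

/-- The neighbours of a vertex of a longest cycle outside the cycle form a clique. -/
theorem adj_of_common_attachment (h : G.IsLongestCycle f c) (hG : G.ClawFree) {d e x : V}
    (hd : d ∉ Set.range f) (he : e ∉ Set.range f) (hx : x ∈ Set.range f) (hxd : G.Adj x d)
    (hxe : G.Adj x e) (hde : d ≠ e) : G.Adj d e := by
  obtain ⟨i, rfl⟩ := hx
  rcases hG.adj_of_adj hxd hxe (h.adj i) hde (fun e => hd ⟨_, e.symm⟩)
    (fun e => he ⟨_, e.symm⟩) with h1 | h1 | h1
  · exact h1
  · exact (h.not_adj_succ hd hxd.symm h1).elim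
  · exact (h.not_adj_succ he hxe.symm h1).elim

/-- The two neighbours on a longest cycle of a vertex with a neighbour outside the cycle are
adjacent. -/
theorem adj_of_attached (h : G.IsLongestCycle f c) (hG : G.ClawFree) {i : ℤ} {d : V}
    (hd : d ∉ Set.range f) (hdi : G.Adj d (f i)) : G.Adj (f (i - 1)) (f (i + 1)) := by
  have hc := h.three_le
  have h1 : G.Adj (f i) (f (i - 1)) := by
    have := h.adj (i - 1); rw [sub_add_cancel] at this; exact this.symm
  have hne : f (i - 1) ≠ f (i + 1) := by
    intro he
    have := Int.eq_zero_of_abs_lt_dvd (h.dvd_of_eq _ _ he) (by rw [abs_lt]; omega)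
    omega
  -- The vertex `f i` is the centre of a potential claw with leaves `f (i - 1)`, `f (i + 1)` and
  -- `d`; an edge from `d` to either of the first two would let `d` be inserted into the cycle.
  rcases hG.adj_of_adj h1 (h.adj i) hdi.symm hne (fun e => hd ⟨_, e⟩) (fun e => hd ⟨_, e⟩) with
    h2 | h2 | h2
  · exact h2
  · exact (h.not_adj_succ hd h2.symm (by rwa [sub_add_cancel])).elim
  · exact (h.not_adj_succ hd hdi h2.symm).elim

/-- The ends of an ear of a longest cycle are far apart on the cycle. -/
theorem gap_of_ear (h : G.IsLongestCycle f c) (hG : G.ClawFree) {D : List V} {i j : ℤ}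
    (hD : G.Ear f D (f i) (f j)) (hij : i < j) (hjc : j < i + c) :
    i + D.length + 3 ≤ j := by
  obtain ⟨⟨a, b, hw, ha, hb⟩, hnd, hDf⟩ := id hD
  have hk := hw.length_pos
  have hci := h.adj_of_attached hG (hDf a hw.head_mem) ha.symm
  have hcj := h.adj_of_attached hG (hDf b hw.last_mem) hb
  by_contra! hlt
  -- The distance from `i` to `j` is `g`; the complementary arc, from `j` to the vertex before `i`,
  -- has `m` vertices.
  obtain ⟨g, hg⟩ : ∃ g : ℕ, j = i + g := ⟨(j - i).toNat, by omega⟩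
  obtain ⟨m, hm⟩ : ∃ m : ℕ, c = g + m := ⟨c - g, by omega⟩
  have hDr := hw.reverse
  have key : seg f j (m + g) = seg f j m ++ seg f i g := by
    rw [seg_add, hg]
    congr 1
    have e : i + (g : ℤ) + m = i + c := by rw [hm]; push_cast; ring
    simp only [seg, e]
    congr 1
    funext t
    rw [add_right_comm, h.periodic]
  have hn : (seg f j m ++ seg f i g ++ D).Nodup := by
    rw [← key]
    exact h.nodup_append _ (by omega) hnd hDf
  have hS := walkList_seg h.adj j (n := m) (by omega)
  have hend : f (j + m - 1) = f (i - 1) := by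
    have e : j + m - 1 = (i - 1) + c := by rw [hg, hm]; push_cast; ring
    rw [e, h.periodic]
  rw [hend] at hS
  have hi := h.adj (i - 1)
  rw [sub_add_cancel] at hi
  -- For `g = 1` the ear replaces an edge of the cycle. For `g = 2` the chord at `i` allows `f (i +
  -- 1)` to be visited before `f i`, so nothing is lost. For `g ≥ 3` the chords at both attachments
  -- are used; the cycle turns at `f (i + 1)` and `f (j - 1)` and loses only the `g - 3` vertices
  -- between them, fewer than the ear contributes.
  rcases (by omega : g = 1 ∨ g = 2 ∨ 3 ≤ g) with rfl | rfl | hg3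
  · refine h.false_of_walkList ((hS.append hi (.single (f i))).append ha hw) hb ?_ (by simp; omega)
    rw [seg_one] at hn
    exact hn
  · have hw' := ((hS.append hci (.single (f (i + 1)))).append (h.adj i).symm
      (.single (f i))).append ha hw
    refine h.false_of_walkList hw' hb ?_ (by simp; omega)
    refine (List.Perm.nodup_iff ?_).1 hn
    refine List.Perm.append_right _ ?_
    rw [List.append_assoc]
    refine List.Perm.append_left _ ?_
    have : seg f i 2 = [f i, f (i + 1)] := by simp [seg, List.range_succ]
    rw [this]
    exact List.Perm.swap _ _ _
  · have hjm : G.Adj (f (j - 1)) (f j) := by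
      have := h.adj (j - 1); rwa [sub_add_cancel] at this
    -- The next cycle needs a vertex of the complementary arc besides `f j`. If `m = 1`, the
    -- attachments are consecutive the other way round, and the ear again replaces an edge.
    have hm2 : 2 ≤ m := by
      by_contra! hm1
      obtain rfl : m = 1 := by omega
      have hS := walkList_seg h.adj i (n := g + 1) (by omega)
      have e : i + ((g + 1 : ℕ) : ℤ) - 1 = j := by rw [hg]; push_cast; ring
      rw [e] at hS
      refine h.false_of_walkList (hS.append hb.symm hDr) ha.symm ?_ (by simp; omega)
      exact h.nodup_append _ (by omega) (by simpa using hnd) (by simpa using hDf)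
    obtain ⟨r, rfl⟩ : ∃ r, m = r + 1 := ⟨m - 1, by omega⟩
    have hT := walkList_seg h.adj (j + 1) (n := r) (by omega)
    have e : j + 1 + (r : ℤ) - 1 = j + (r + 1 : ℕ) - 1 := by push_cast; ring
    rw [e, hend] at hT
    have hw' := ((((hT.append hci (.single (f (i + 1)))).append (h.adj i).symm
      (.single (f i))).append ha hw).append hb (.single (f j))).append hjm.symm
      (.single (f (j - 1)))
    refine h.false_of_walkList hw' hcj ?_ (by simp; omega)
    classical
    -- Counting occurrences of a single vertex reduces the comparison of rearranged lists to linear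
    -- arithmetic.
    rw [List.nodup_iff_count_le_one] at hn ⊢
    intro v
    have hv := hn v
    obtain ⟨q, rfl⟩ : ∃ q, g = 2 + (q + 1) := ⟨g - 3, by omega⟩
    have e1 : seg f j (r + 1) = [f j] ++ seg f (j + 1) r := by
      rw [add_comm, seg_add, seg_one]; simp
    have e2 : seg f i (2 + (q + 1)) = [f i, f (i + 1)] ++ (seg f (i + 2) q ++ [f (j - 1)]) := by
      rw [seg_add, seg_add, seg_one]
      have : seg f i 2 = [f i, f (i + 1)] := by simp [seg, List.range_succ]
      rw [this]
      have : i + 2 + (q : ℤ) = j - 1 := by rw [hg]; push_cast; ring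
      simp [this]
    rw [e1, e2] at hv
    simp only [List.count_append, List.count_cons, List.count_nil] at hv ⊢
    omega

end IsLongestCycle

end SimpleGraph

/-! ### Splits: rerouting the cycle so as to include several ears -/

namespace SimpleGraph

variable {V : Type*} {G : SimpleGraph V} {f : ℤ → V} {c : ℕ}

namespace IsLongestCycle

/-- An interval of at most four vertices whose ends have neighbours outside the cycle. -/
theorem split_of_attached (h : G.IsLongestCycle f c) (hG : G.ClawFree) {s : ℤ} {n : ℕ} {d e : V}
    (hd : d ∉ Set.range f) (he : e ∉ Set.range f) (hds : G.Adj d (f s))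
    (hes : G.Adj e (f (s + n))) (hn : 1 ≤ n) (hn3 : n ≤ 3) :
    G.Split f s (n + 1) (f s) (f (s + n)) := by
  have h1 := h.adj_of_attached hG hd hds
  have h2 := h.adj_of_attached hG he hes
  have a1 := h.adj (s - 1)
  have a2 := h.adj s
  have a3 := h.adj (s + n)
  have a4 := h.adj (s + 1)
  have a5 := h.adj (s + 2)
  rw [sub_add_cancel] at a1
  have e4 : s + 1 + 1 = s + 2 := by ring
  have e5 : s + 2 + 1 = s + 3 := by ring
  rw [e4] at a4
  rw [e5] at a5
  -- The intervals of 2, 3 and 4 vertices are cut as `s | s+1`, as `s+1, s | s+2` and as `s+1, s |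
  -- s+3, s+2`. A part written in reverse order is entered or left along the chord at its
  -- attachment.
  interval_cases n
  · refine ⟨[f s], [f (s + 1)], f s, f (s + 1), .single _, .single _, a1, ?_, ?_⟩
    · push_cast
      exact a4
    · simp [seg, List.range_succ]
  · refine ⟨[f (s + 1), f s], [f (s + 2)], f (s + 1), f (s + 2), .pair a2.symm, .single _, h1,
      ?_, ?_⟩
    · push_cast
      simpa [add_assoc] using a3
    · simp only [seg, List.range_succ, List.range_zero, List.map_cons, List.map_nil,
        List.nil_append, List.cons_append]
      simpa using List.Perm.swap _ _ _
  · refine ⟨[f (s + 1), f s], [f (s + 3), f (s + 2)], f (s + 1), f (s + 2), .pair a2.symm,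
      .pair a5.symm, h1, ?_, ?_⟩
    · push_cast
      have e1 : s + 3 - 1 = s + 2 := by ring
      have h2' : G.Adj (f (s + 3 - 1)) (f (s + 3 + 1)) := by simpa using h2
      rw [e1] at h2'
      simpa [add_assoc] using h2'
    · simp only [seg, List.range_succ, List.range_zero, List.map_cons, List.map_nil,
        List.nil_append, List.cons_append]
      simpa using (List.Perm.swap _ _ _).trans
        (((List.Perm.swap _ _ _).cons _).cons _)

/-- Two consecutive vertices with neighbours outside the cycle may be exchanged. -/
theorem split_swap_of_attached (h : G.IsLongestCycle f c) (hG : G.ClawFree) {s : ℤ} {d e : V}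
    (hd : d ∉ Set.range f) (he : e ∉ Set.range f) (hds : G.Adj d (f s))
    (hes : G.Adj e (f (s + 1))) : G.Split f s 2 (f (s + 1)) (f s) := by
  have h1 := h.adj_of_attached hG hd hds
  have h2 := h.adj_of_attached hG he hes
  rw [add_sub_cancel_right, add_assoc] at h2
  refine ⟨[f (s + 1)], [f s], f (s + 1), f s, .single _, .single _, h1, ?_, ?_⟩
  · simpa using h2
  · simp only [seg, List.range_succ, List.range_zero, List.map_cons, List.map_nil,
        List.nil_append, List.cons_append]
    simpa using List.Perm.swap _ _ _

theorem walkList_seg_between (h : G.IsLongestCycle f c) (s t : ℤ) {m : ℕ} (hm : 1 ≤ m)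
    (hst : (c : ℤ) ∣ s + m - t) : G.WalkList (f s) (f (t - 1)) (seg f s m) := by
  have := walkList_seg h.adj s hm
  have e : f (s + m - 1) = f (t - 1) := (h.eq_of_dvd (by convert hst using 1; ring)).symm
  rwa [e] at this

/-- Two ears joined to both sides of a split give a path through the whole cycle. -/
theorem exists_walkList_of_split (h : G.IsLongestCycle f c) {Du Dw : List V} {u u' w w' : V}
    {s : ℤ} {n m : ℕ} (hm : 1 ≤ m) (hc : n + m = c) (hu : G.Ear f Du u u') (hw : G.Ear f Dw w w')
    (hs : G.Split f s n u w) :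
    ∃ a b l, G.WalkList a b l ∧ l.Perm (seg f s c ++ Du ++ Dw) := by
  obtain ⟨⟨ua, ub, u1, u2, -⟩, -, -⟩ := hu
  obtain ⟨⟨wa, wb, w1, w2, -⟩, -, -⟩ := hw
  obtain ⟨X, Y, x₀, y₀, s1, s2, s3, s4, s5⟩ := hs
  have hS := h.walkList_seg_between (s + n) s hm ⟨1, by subst hc; push_cast; ring⟩
  -- The path runs through `Du`, leaves the split on the left, follows the rest of the cycle
  -- backwards, enters the split from the right and ends in `Dw`.
  refine ⟨_, _, _, (((u1.reverse.append u2.symm s1.reverse).append s3.symm hS.reverse).append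
    s4.symm s2.reverse).append w2 w1, ?_⟩
  subst hc
  classical
  rw [List.perm_iff_count] at s5 ⊢
  intro v
  have := s5 v
  simp only [seg_add, List.count_append, List.count_reverse] at this ⊢
  omega

/-- Two ears joining both sides of a split to the corresponding sides of another one give a
longer cycle. -/
theorem false_of_two_splits (h : G.IsLongestCycle f c) {Du Dw : List V} {u u' w w' : V}
    {s₁ s₂ : ℤ} {n₁ m₁ n₂ m₂ : ℕ} (hm₁ : 1 ≤ m₁) (hm₂ : 1 ≤ m₂) (hc : n₁ + m₁ + n₂ + m₂ = c)
    (hs : s₂ = s₁ + n₁ + m₁) (hu : G.Ear f Du u u') (hw : G.Ear f Dw w w')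
    (hd : (Du ++ Dw).Nodup)
    (h₁ : G.Split f s₁ n₁ u w) (h₂ : G.Split f s₂ n₂ u' w') : False := by
  have hnd : (seg f s₁ c ++ (Du ++ Dw)).Nodup := by
    refine h.nodup_append _ le_rfl hd ?_
    intro x hx
    rcases List.mem_append.1 hx with hx | hx
    · exact hu.2.2 x hx
    · exact hw.2.2 x hx
  have hul := hu.length_pos
  obtain ⟨⟨ua, ub, u1, u2, u3⟩, -, -⟩ := hu
  obtain ⟨⟨wa, wb, w1, w2, w3⟩, -, -⟩ := hw
  obtain ⟨X, Y, x₀, y₀, s1, s2, s3, s4, s5⟩ := h₁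
  obtain ⟨X', Y', x₀', y₀', t1, t2, t3, t4, t5⟩ := h₂
  have hS₁ := h.walkList_seg_between (s₁ + n₁) s₂ hm₁ ⟨0, by rw [hs]; ring⟩
  have hS₂ := h.walkList_seg_between (s₂ + n₂) s₁ hm₂ ⟨1, by subst hc hs; push_cast; ring⟩
  -- The cycle follows the first arc into the left part of the second split, returns through `Du` to
  -- the first split, leaves that on the left, follows the second arc backwards into the right part
  -- of the second split, and returns through `Dw` to the right part of the first.
  have hW := ((((((hS₁.append t3 t1).append u3.symm u1.reverse).append u2.symm
    s1.reverse).append s3.symm hS₂.reverse).append t4.symm t2.reverse).append w3.symm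
    w1.reverse).append w2.symm s2
  have hP : (seg f (s₁ + n₁) m₁ ++ X' ++ Du.reverse ++ X.reverse ++ (seg f (s₂ + n₂) m₂).reverse ++
      Y'.reverse ++ Dw.reverse ++ Y).Perm (seg f s₁ c ++ (Du ++ Dw)) := by
    subst hc hs
    classical
    rw [List.perm_iff_count] at s5 t5 ⊢
    intro v
    have := s5 v
    have := t5 v
    simp only [seg_add, List.count_append, List.count_reverse, Nat.cast_add, ← add_assoc] at *
    omega
  refine h.false_of_walkList hW s4 (hP.nodup_iff.2 hnd) ?_
  rw [hP.length_eq]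
  simp
  omega

/-- Two splits having one ear in common on their right-hand sides. -/
theorem exists_walkList_of_two_splits (h : G.IsLongestCycle f c) {Du Dw Dz : List V}
    {u u' w w' z z' : V}
    {s₁ s₂ : ℤ} {n₁ m₁ n₂ m₂ : ℕ} (hm₁ : 1 ≤ m₁) (hm₂ : 1 ≤ m₂) (hc : n₁ + m₁ + n₂ + m₂ = c)
    (hs : s₂ = s₁ + n₁ + m₁) (hu : G.Ear f Du u u') (hw : G.Ear f Dw w w')
    (hz : G.Ear f Dz z z')
    (h₁ : G.Split f s₁ n₁ u w) (h₂ : G.Split f s₂ n₂ z w') :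
    ∃ a b l, G.WalkList a b l ∧ l.Perm (seg f s₁ c ++ Du ++ Dw ++ Dz) := by
  obtain ⟨⟨ua, ub, u1, u2, u3⟩, -, -⟩ := hu
  obtain ⟨⟨wa, wb, w1, w2, w3⟩, -, -⟩ := hw
  obtain ⟨⟨za, zb, z1, z2, z3⟩, -, -⟩ := hz
  obtain ⟨X, Y, x₀, y₀, s1, s2, s3, s4, s5⟩ := h₁
  obtain ⟨X', Y', x₀', y₀', t1, t2, t3, t4, t5⟩ := h₂
  have hS₁ := h.walkList_seg_between (s₁ + n₁) s₂ hm₁ ⟨0, by rw [hs]; ring⟩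
  have hS₂ := h.walkList_seg_between (s₂ + n₂) s₁ hm₂ ⟨1, by subst hc hs; push_cast; ring⟩
  -- Only `Dw`, in the middle, is traversed from attachment to attachment; `Du` and `Dz` are the two
  -- ends of the path, so one attachment of each suffices.
  refine ⟨_, _, _, (((((((u1.reverse.append u2.symm s1.reverse).append s3.symm
    hS₂.reverse).append t4.symm t2.reverse).append w3.symm w1.reverse).append w2.symm s2).append s4
    hS₁).append t3 t1).append z2 z1, ?_⟩
  subst hc hs
  classical
  rw [List.perm_iff_count] at s5 t5 ⊢
  intro v
  have := s5 v
  have := t5 v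
  simp only [seg_add, List.count_append, List.count_reverse, Nat.cast_add, ← add_assoc] at *
  omega

/-- Two splits having one ear in common on their left-hand sides. -/
theorem exists_walkList_of_two_splits' (h : G.IsLongestCycle f c) {Du Dw Dz : List V}
    {u u' w w' z z' : V}
    {s₁ s₂ : ℤ} {n₁ m₁ n₂ m₂ : ℕ} (hm₁ : 1 ≤ m₁) (hm₂ : 1 ≤ m₂) (hc : n₁ + m₁ + n₂ + m₂ = c)
    (hs : s₂ = s₁ + n₁ + m₁) (hu : G.Ear f Du u u') (hw : G.Ear f Dw w w')
    (hz : G.Ear f Dz z z')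
    (h₁ : G.Split f s₁ n₁ w u) (h₂ : G.Split f s₂ n₂ w' z) :
    ∃ a b l, G.WalkList a b l ∧ l.Perm (seg f s₁ c ++ Du ++ Dw ++ Dz) := by
  obtain ⟨⟨ua, ub, u1, u2, u3⟩, -, -⟩ := hu
  obtain ⟨⟨wa, wb, w1, w2, w3⟩, -, -⟩ := hw
  obtain ⟨⟨za, zb, z1, z2, z3⟩, -, -⟩ := hz
  obtain ⟨X, Y, x₀, y₀, s1, s2, s3, s4, s5⟩ := h₁
  obtain ⟨X', Y', x₀', y₀', t1, t2, t3, t4, t5⟩ := h₂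
  have hS₁ := h.walkList_seg_between (s₁ + n₁) s₂ hm₁ ⟨0, by rw [hs]; ring⟩
  have hS₂ := h.walkList_seg_between (s₂ + n₂) s₁ hm₂ ⟨1, by subst hc hs; push_cast; ring⟩
  refine ⟨_, _, _, (((((((u1.reverse.append u2.symm s2).append s4
    hS₁).append t3 t1).append w3.symm w1.reverse).append w2.symm s1.reverse).append s3.symm
    hS₂.reverse).append t4.symm t2.reverse).append z2 z1, ?_⟩
  subst hc hs
  classical
  rw [List.perm_iff_count] at s5 t5 ⊢
  intro v
  have := s5 v
  have := t5 v
  simp only [seg_add, List.count_append, List.count_reverse, Nat.cast_add, ← add_assoc] at *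
  omega

/-- Three ears joining three splits so that a single longer cycle results. -/
theorem false_of_three_splits (h : G.IsLongestCycle f c) {Du Dw Dz : List V}
    {u u' w w' z z' : V} {s₁ s₂ s₃ : ℤ} {n₁ m₁ n₂ m₂ n₃ m₃ : ℕ} (hm₁ : 1 ≤ m₁) (hm₂ : 1 ≤ m₂)
    (hm₃ : 1 ≤ m₃) (hc : n₁ + m₁ + n₂ + m₂ + n₃ + m₃ = c)
    (hs₂ : s₂ = s₁ + n₁ + m₁) (hs₃ : s₃ = s₂ + n₂ + m₂)
    (hu : G.Ear f Du u u') (hw : G.Ear f Dw w w') (hz : G.Ear f Dz z z')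
    (hd : (Du ++ Dw ++ Dz).Nodup)
    (h₁ : G.Split f s₁ n₁ u w) (h₂ : G.Split f s₂ n₂ u' z) (h₃ : G.Split f s₃ n₃ w' z') :
    False := by
  have hnd : (seg f s₁ c ++ (Du ++ Dw ++ Dz)).Nodup := by
    refine h.nodup_append _ le_rfl hd ?_
    intro x hx
    simp only [List.mem_append] at hx
    rcases hx with (hx | hx) | hx
    · exact hu.2.2 x hx
    · exact hw.2.2 x hx
    · exact hz.2.2 x hx
  have hul := hu.length_pos
  obtain ⟨⟨ua, ub, u1, u2, u3⟩, -, -⟩ := hu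
  obtain ⟨⟨wa, wb, w1, w2, w3⟩, -, -⟩ := hw
  obtain ⟨⟨za, zb, z1, z2, z3⟩, -, -⟩ := hz
  obtain ⟨X, Y, x₀, y₀, s1, s2, s3, s4, s5⟩ := h₁
  obtain ⟨X', Y', x₀', y₀', t1, t2, t3, t4, t5⟩ := h₂
  obtain ⟨X'', Y'', x₀'', y₀'', r1, r2, r3, r4, r5⟩ := h₃
  have hS₁ := h.walkList_seg_between (s₁ + n₁) s₂ hm₁ ⟨0, by rw [hs₂]; ring⟩
  have hS₂ := h.walkList_seg_between (s₂ + n₂) s₃ hm₂ ⟨0, by rw [hs₃]; ring⟩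
  have hS₃ := h.walkList_seg_between (s₃ + n₃) s₁ hm₃
    ⟨1, by subst hc hs₂ hs₃; push_cast; ring⟩
  -- All three arcs, all six parts of the splits and all three ears are traversed once, the third
  -- arc backwards.
  have hW := ((((((((((hS₁.append t3 t1).append u3.symm u1.reverse).append u2.symm
    s1.reverse).append s3.symm hS₃.reverse).append r4.symm r2.reverse).append z3.symm
    z1.reverse).append z2.symm t2).append t4 hS₂).append r3 r1).append w3.symm w1.reverse).append
    w2.symm s2
  have hP : (seg f (s₁ + n₁) m₁ ++ X' ++ Du.reverse ++ X.reverse ++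
      (seg f (s₃ + n₃) m₃).reverse ++ Y''.reverse ++ Dz.reverse ++ Y' ++ seg f (s₂ + n₂) m₂ ++
      X'' ++ Dw.reverse ++ Y).Perm (seg f s₁ c ++ (Du ++ Dw ++ Dz)) := by
    subst hc hs₂ hs₃
    classical
    rw [List.perm_iff_count] at s5 t5 r5 ⊢
    intro v
    have := s5 v
    have := t5 v
    have := r5 v
    simp only [seg_add, List.count_append, List.count_reverse, Nat.cast_add, ← add_assoc] at *
    omega
  refine h.false_of_walkList hW s4 (hP.nodup_iff.2 hnd) ?_
  rw [hP.length_eq]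
  simp
  omega

end IsLongestCycle

end SimpleGraph

/-! ### A longest ear with at most three vertices has no further neighbours off the cycle -/

namespace SimpleGraph

variable {V : Type*} {G : SimpleGraph V} {f : ℤ → V} {W : Set V}

/-- An ear within `W` whose ends are joined to distinct vertices in the range of `f`. -/
def EarIn (G : SimpleGraph V) (f : ℤ → V) (W : Set V) (D : List V) (u v : V) : Prop :=
  G.Ear f D u v ∧ u ∈ Set.range f ∧ v ∈ Set.range f ∧ u ≠ v ∧ ∀ x ∈ D, x ∈ W

theorem EarIn.reverse {D : List V} {u v : V} (h : G.EarIn f W D u v) :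
    G.EarIn f W D.reverse v u :=
  ⟨h.1.reverse, h.2.2.1, h.2.1, h.2.2.2.1.symm, by simpa using h.2.2.2.2⟩

/-- `W` is a union of vertex sets of components of the graph outside the range of `f`. -/
def IsClosedOff (G : SimpleGraph V) (f : ℤ → V) (W : Set V) : Prop :=
  (∀ x ∈ W, x ∉ Set.range f) ∧ ∀ x ∈ W, ∀ y, G.Adj x y → y ∉ Set.range f → y ∈ W

namespace IsClosedOff

theorem mem_of_walkList (hW : G.IsClosedOff f W) {a b : V} {l : List V} (h : G.WalkList a b l)
    (ha : a ∈ W) (hl : ∀ x ∈ l, x ∉ Set.range f) : ∀ x ∈ l, x ∈ W := by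
  induction l generalizing a with
  | nil => simp
  | cons y l ih =>
    obtain rfl : y = a := by simpa using h.2.1
    rintro x hx
    rcases List.mem_cons.1 hx with rfl | hx
    · exact ha
    · cases l with
      | nil => simp at hx
      | cons z l =>
        have h1 := h.1
        rw [List.isChain_cons_cons] at h1
        refine ih (a := z) ⟨h1.2, by simp, by simpa using h.2.2⟩ ?_
          (fun x hx => hl x (List.mem_cons_of_mem _ hx)) x hx
        exact hW.2 y ha z h1.1 (hl z (by simp))

theorem earIn (hW : G.IsClosedOff f W) {a b u v : V} {L : List V} (h : G.WalkList a b L)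
    (hn : L.Nodup) (hL : ∀ x ∈ L, x ∈ W) (hu : G.Adj u a) (hv : G.Adj b v)
    (hur : u ∈ Set.range f) (hvr : v ∈ Set.range f) (huv : u ≠ v) : G.EarIn f W L u v :=
  ⟨⟨⟨a, b, h, hu, hv⟩, hn, fun x hx => hW.1 x (hL x hx)⟩, hur, hvr, huv, hL⟩

/-- Every lengthening of an ear `D` below uses such a path `Q`: starting at a vertex `y` next to
`D`, it avoids the chosen vertex `p` and comes to the cycle or back to `D`. -/
theorem exists_escape [Finite V] (hW : G.IsClosedOff f W) (hG : G.TwoConnected) {D : List V}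
    {y p t : V} (hy : y ∈ W) (hyD : y ∉ D) (hyp : y ≠ p) (ht : t ∈ Set.range f) (htp : t ≠ p) :
    ∃ Q z s, G.WalkList y z Q ∧ Q.Nodup ∧ (∀ q ∈ Q, q ∈ W) ∧ (∀ q ∈ Q, q ∉ D) ∧ p ∉ Q ∧
      (s ∈ Set.range f ∨ s ∈ D) ∧ s ≠ p ∧ G.Adj z s := by
  obtain ⟨Q, z, s, h1, h2, h3, h4, h5, h6, h7⟩ :=
    hG.exists_walkList_to_set (T := Set.range f ∪ {x | x ∈ D}) (y := y) (p := p)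
      (by rintro (h | h); exacts [hW.1 y hy h, hyD h]) hyp (Or.inl ht) htp
  exact ⟨Q, z, s, h1, h2,
    hW.mem_of_walkList h1 hy (fun q hq hqf => h3 q hq (Or.inl hqf)),
    fun q hq hqD => h3 q hq (Or.inr hqD), fun hp => h4 p hp rfl, h5, h6, h7⟩

/-- A first escape yields a vertex `z` of `W` with a neighbour `s` on the cycle. A second escape,
from `z` and avoiding `s`, reaches another vertex of the cycle and is the desired ear. -/
theorem exists_earIn [Finite V] (hW : G.IsClosedOff f W) (hG : G.TwoConnected)
    (hf : f 0 ≠ f 1) (hne : W.Nonempty) : ∃ D u v, G.EarIn f W D u v := by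
  obtain ⟨x, hx⟩ := hne
  have hx0 : x ≠ f 0 := fun e => hW.1 x hx ⟨0, e.symm⟩
  have hx1 : x ≠ f 1 := fun e => hW.1 x hx ⟨1, e.symm⟩
  obtain ⟨Q, z, s, h1, h2, h3, -, -, h5, -, h7⟩ :=
    hW.exists_escape hG (D := []) (p := f 0) hx (by simp) hx0 ⟨1, rfl⟩ hf.symm
  have hs : s ∈ Set.range f := by simpa using h5
  have hz := h3 z h1.last_mem
  classical
  obtain ⟨Q', z', s', h1', h2', h3', -, -, h5', h6', h7'⟩ :=
    hW.exists_escape hG (D := []) (p := s) (y := z) (t := if s = f 0 then f 1 else f 0)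
      hz (by simp) (fun e => hW.1 z hz (e ▸ hs)) (by split_ifs; exacts [⟨1, rfl⟩, ⟨0, rfl⟩])
      (by split_ifs with h; exacts [h ▸ hf.symm, Ne.symm h])
  exact ⟨Q', s, s', hW.earIn h1' h2' h3' h7.symm h7' hs (by simpa using h5') h6'.symm⟩

/-- An escape from `y` that avoids `a` ends on the cycle. Preceded by `a`, it is a longer ear
starting at whichever of `u`, `v` is not its other attachment. -/
theorem not_adj_of_max_one [Finite V] (hW : G.IsClosedOff f W) (hG : G.TwoConnected)
    {a u v y : V} (hD : G.EarIn f W [a] u v)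
    (hmax : ∀ L u v, G.EarIn f W L u v → L.length ≤ 1)
    (hy : y ∈ W) (hya : y ≠ a) : ¬ G.Adj a y := by
  intro hay
  obtain ⟨⟨⟨a', b', hw, hu, hv⟩, -, -⟩, hur, hvr, huv, hDW⟩ := hD
  obtain ⟨-, ha, hb⟩ := hw
  simp at ha hb
  subst ha hb
  have haW : a ∈ W := hDW a (by simp)
  obtain ⟨Q, z, s, h1, h2, h3, h4, h5, h6, h7, h8⟩ :=
    hW.exists_escape hG (D := [a]) (p := a) hy (by simpa using hya) hya hur hu.ne
  have hs : s ∈ Set.range f := by simpa [h7] using h6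
  have key : ∀ x, G.Adj x a → x ∈ Set.range f → x ≠ s → False := by
    intro x hx hxr hxs
    have := hmax _ _ _ (hW.earIn (h1.cons hay) (List.nodup_cons.2 ⟨h5, h2⟩)
      (by simpa [haW] using h3) hx h8 hxr hs hxs)
    have := h1.length_pos
    simp only [List.length_cons] at *
    omega
  by_cases hus : u = s
  · exact key v hv.symm hvr (fun h => huv (hus.trans h.symm))
  · exact key u hu hur hus

/-- Among the neighbours `u`, `y`, `b` of `a`, the edges `uy` and `yb` immediately give an ear with
three vertices. If `ub` is an edge, then `b` is joined to both `u` and `v`, and an escape from `y`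
gives the ear `b, a, Q`, or `a, Q, b` if it returns to `b`. -/
theorem not_adj_of_max_two [Finite V] (hW : G.IsClosedOff f W) (hG : G.TwoConnected)
    (hGc : G.ClawFree) {a b u v y : V} (hD : G.EarIn f W [a, b] u v)
    (hmax : ∀ L u v, G.EarIn f W L u v → L.length ≤ 2)
    (hy : y ∈ W) (hya : y ≠ a) (hyb : y ≠ b) : ¬ G.Adj a y := by
  intro hay
  obtain ⟨⟨⟨a', b', ⟨hab, ha, hb⟩, hu, hv⟩, hnd, -⟩, hur, hvr, huv, hDW⟩ := hD
  simp at ha hb hab hnd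
  subst ha hb
  have haW : a ∈ W := hDW a (by simp)
  have hbW : b ∈ W := hDW b (by simp)
  have hub : u ≠ b := fun e => hW.1 b hbW (e ▸ hur)
  have huy : u ≠ y := fun e => hW.1 y hy (e ▸ hur)
  rcases hGc.adj_of_adj hu.symm hay hab huy hub hyb with h | h | h
  · have := hmax _ _ _ (hW.earIn (L := [y, a, b]) (((WalkList.single b).cons hab).cons hay.symm)
      (by simp [*]) (by simp [*]) h hv hur hvr huv)
    simp at this
  · obtain ⟨Q, z, s, h1, h2, h3, h4, h5, h6, h7, h8⟩ :=
      hW.exists_escape hG (D := [a, b]) (p := a) hy (by simp [*]) hya hur hu.ne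
    have hQb : b ∉ Q := fun hb => h4 b hb (by simp)
    have hQ := h1.length_pos
    have hs : s ∈ Set.range f ∨ s = b := by simpa [h7] using h6
    rcases hs with hs | rfl
    · have key : ∀ x, G.Adj x b → x ∈ Set.range f → x ≠ s → False := by
        intro x hx hxr hxs
        have := hmax _ _ _ (hW.earIn ((h1.cons hay).cons hab.symm) (by simp [*, Ne.symm hnd])
          (by simpa [haW, hbW] using h3) hx h8 hxr hs hxs)
        simp only [List.length_cons] at *
        omega
      by_cases hus : u = s
      · exact key v hv.symm hvr (fun h => huv (hus.trans h.symm))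
      · exact key u h hur hus
    · have := hmax _ _ _ (hW.earIn ((h1.cons hay).append h8 (.single s))
        (by
          rw [List.nodup_append]
          refine ⟨by simp [*], by simp, ?_⟩
          rintro x hx w hw rfl
          simp at hw hx
          subst hw
          rcases hx with hx | hx
          · exact hnd hx.symm
          · exact hQb hx)
        (by
          intro x hx
          simp at hx
          rcases hx with rfl | hx | rfl
          exacts [haW, h3 _ hx, hbW]) hu hv hur hvr huv)
      simp only [List.length_cons, List.length_append, List.length_nil] at this
      omega
  · have := hmax _ _ _ (hW.earIn (L := [a, y, b]) (((WalkList.single b).cons h).cons hay)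
      (by simp [*, Ne.symm hya]) (by simp [*]) hu hv hur hvr huv)
    simp at this

/-- The same analysis of `u`, `y`, `b` at the vertex `a` applies; the edge `ub` again leaves only an
escape `Q` to be considered. The hypothesis `hcl` is needed only when `Q` ends at `v`, the
attachment of the other end of the ear. -/
theorem not_adj_head_of_max_three [Finite V] (hW : G.IsClosedOff f W) (hG : G.TwoConnected)
    (hGc : G.ClawFree)
    (hcl : ∀ d e x, d ∉ Set.range f → e ∉ Set.range f → x ∈ Set.range f → G.Adj x d → G.Adj x e →
      d ≠ e → G.Adj d e) {a b e u v y : V} (hD : G.EarIn f W [a, b, e] u v)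
    (hmax : ∀ L u v, G.EarIn f W L u v → L.length ≤ 3)
    (hy : y ∈ W) (hya : y ≠ a) (hyb : y ≠ b) (hye : y ≠ e) : ¬ G.Adj a y := by
  intro hay
  obtain ⟨⟨⟨a', b', ⟨hab, ha, hb⟩, hu, hv⟩, hnd, -⟩, hur, hvr, huv, hDW⟩ := hD
  simp at ha hb hab hnd
  subst ha hb
  obtain ⟨hab, hbe⟩ := hab
  obtain ⟨⟨nab, nae⟩, nbe⟩ := hnd
  have haW : a ∈ W := hDW a (by simp)
  have hbW : b ∈ W := hDW b (by simp)
  have heW : e ∈ W := hDW e (by simp)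
  have hub : u ≠ b := fun e => hW.1 b hbW (e ▸ hur)
  have huy : u ≠ y := fun e => hW.1 y hy (e ▸ hur)
  have hve : v ≠ e := fun h => hW.1 e heW (h ▸ hvr)
  rcases hGc.adj_of_adj hu.symm hay hab huy hub hyb with h | h | h
  · have := hmax _ _ _ (hW.earIn (L := [y, a, b, e])
      ((((WalkList.single e).cons hbe).cons hab).cons hay.symm)
      (by simp [*]) (by simp [*]) h hv hur hvr huv)
    simp at this
  · obtain ⟨Q, z, s, h1, h2, h3, h4, h5, h6, h7, h8⟩ :=
      hW.exists_escape hG (D := [a, b, e]) (p := a) hy (by simp [*]) hya hur hu.ne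
    have hQb : b ∉ Q := fun hb => h4 b hb (by simp)
    have hQe : e ∉ Q := fun hb => h4 e hb (by simp)
    have hQ := h1.length_pos
    have hs : s ∈ Set.range f ∨ s = b ∨ s = e := by simpa [h7] using h6
    rcases hs with hs | rfl | rfl
    · by_cases hvs : v = s
      · subst hvs
        -- The ear `b, a, Q` from `u` to `v` has at most three vertices, so `Q` is `y` alone. Then
        -- `y` and `e` are both joined to `v`, hence adjacent by `hcl`, and `b, a, y, e` is too
        -- long.
        have h9 : z = y := by
          by_contra hzy
          have h10 := hmax _ _ _ (hW.earIn ((h1.cons hay).cons hab.symm)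
            (by simp [*, Ne.symm nab]) (by simpa [haW, hbW] using h3) h h8 hur hvr huv)
          obtain ⟨Q', rfl⟩ := h1.eq_cons
          cases Q' with
          | nil => exact hzy (by simpa using h1.2.2.symm)
          | cons =>
            simp only [List.length_cons] at h10
            omega
        subst h9
        have hzea : G.Adj z e := hcl _ _ _ (hW.1 z hy) (hW.1 e heW) hvr h8.symm hv.symm hye
        have := hmax _ _ _ (hW.earIn (L := [b, a, z, e])
          ((((WalkList.single e).cons hzea).cons hay).cons hab.symm)
          (by simp [*, Ne.symm nab, Ne.symm hya, Ne.symm hyb]) (by simp [*]) h hv hur hvr huv)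
        simp at this
      · have := hmax _ _ _ (hW.earIn (((h1.cons hay).cons hab.symm).cons hbe.symm)
          (by simp [*, Ne.symm nab, Ne.symm nae, Ne.symm nbe])
          (by simpa [haW, hbW, heW] using h3) hv.symm h8 hvr hs hvs)
        simp only [List.length_cons] at this
        omega
    · have := hmax _ _ _ (hW.earIn ((h1.cons hay).append h8 ((WalkList.single e).cons hbe))
        (by
          rw [List.nodup_append]
          refine ⟨by simp [*], by simp [*], ?_⟩
          rintro x hx w hw rfl
          simp at hw hx
          rcases hw with rfl | rfl <;> rcases hx with rfl | hx <;> simp_all)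
        (by
          intro x hx
          simp at hx
          rcases hx with rfl | hx | rfl | rfl
          exacts [haW, h3 _ hx, hbW, heW]) hu hv hur hvr huv)
      simp only [List.length_cons, List.length_append, List.length_nil] at this
      omega
    · have := hmax _ _ _ (hW.earIn (((h1.cons hay).cons hab.symm).append h8 (WalkList.single s))
        (by
          rw [List.nodup_append]
          refine ⟨by simp [*, Ne.symm nab], by simp [*], ?_⟩
          rintro x hx w hw rfl
          simp at hw hx
          subst hw
          rcases hx with rfl | rfl | hx <;> simp_all)
        (by
          intro x hx
          simp at hx
          rcases hx with rfl | rfl | hx | rfl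
          exacts [hbW, haW, h3 _ hx, heW]) h hv hur hvr huv)
      simp only [List.length_cons, List.length_append, List.length_nil] at this
      omega
  · have := hmax _ _ _ (hW.earIn (L := [a, y, b, e])
      ((((WalkList.single e).cons hbe).cons h).cons hay)
      (by simp [*, Ne.symm hya]) (by simp [*]) hu hv hur hvr huv)
    simp at this

/-- As `y` is adjacent to neither end, the absence of a claw at `b` makes `a` and `e` adjacent. The
triangle `a, b, e` can then be traversed from either attachment so as to finish at `b`, and an
escape from `y` prolongs it. -/
theorem not_adj_middle_of_max_three [Finite V] (hW : G.IsClosedOff f W) (hG : G.TwoConnected)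
    (hGc : G.ClawFree) {a b e u v y : V} (hD : G.EarIn f W [a, b, e] u v)
    (hmax : ∀ L u v, G.EarIn f W L u v → L.length ≤ 3)
    (hy : y ∈ W) (hya : y ≠ a) (hyb : y ≠ b) (hye : y ≠ e) (hay : ¬ G.Adj a y)
    (hey : ¬ G.Adj e y) : ¬ G.Adj b y := by
  intro hby
  obtain ⟨⟨⟨a', b', ⟨hab, ha, hb⟩, hu, hv⟩, hnd, -⟩, hur, hvr, huv, hDW⟩ := hD
  simp at ha hb hab hnd
  subst ha hb
  obtain ⟨hab, hbe⟩ := hab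
  obtain ⟨⟨nab, nae⟩, nbe⟩ := hnd
  have haW : a ∈ W := hDW a (by simp)
  have hbW : b ∈ W := hDW b (by simp)
  have heW : e ∈ W := hDW e (by simp)
  have hae : G.Adj a e := by
    rcases hGc.adj_of_adj hab.symm hbe hby nae (Ne.symm hya) (Ne.symm hye) with h | h | h
    exacts [h, (hay h).elim, (hey h).elim]
  obtain ⟨Q, z, s, h1, h2, h3, h4, h5, h6, h7, h8⟩ :=
    hW.exists_escape hG (D := [a, b, e]) (p := b) hy (by simp [*]) hyb hur
      (fun e => hW.1 b hbW (e ▸ hur))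
  have hQa : a ∉ Q := fun hb => h4 a hb (by simp)
  have hQe : e ∉ Q := fun hb => h4 e hb (by simp)
  have hQ := h1.length_pos
  have hs : s ∈ Set.range f ∨ s = a ∨ s = e := by simpa [h7] using h6
  rcases hs with hs | rfl | rfl
  · by_cases hus : u = s
    · have := hmax _ _ _ (hW.earIn (((h1.cons hby).cons hab).cons hae.symm)
        (by simp [*, Ne.symm nae, Ne.symm nbe]) (by simpa [haW, hbW, heW] using h3) hv.symm h8 hvr
        hs (fun h => huv (hus.trans h.symm)))
      simp only [List.length_cons] at this
      omega
    · have := hmax _ _ _ (hW.earIn (((h1.cons hby).cons hbe.symm).cons hae)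
        (by simp [*, Ne.symm nbe]) (by simpa [haW, hbW, heW] using h3) hu h8 hur hs hus)
      simp only [List.length_cons] at this
      omega
  · have := hmax _ _ _ (hW.earIn (((h1.reverse.append hby.symm
      ((WalkList.single e).cons hbe))).cons h8.symm)
      (by
        simp only [List.nodup_cons, List.nodup_append, List.nodup_reverse, List.mem_append,
          List.mem_reverse]
        refine ⟨by simp [*], h2, by simp [*], ?_⟩
        rintro x hx w hw rfl
        simp at hw
        rcases hw with rfl | rfl <;> simp_all)
      (by
        intro x hx
        simp at hx
        rcases hx with rfl | hx | rfl | rfl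
        exacts [haW, h3 _ hx, hbW, heW]) hu hv hur hvr huv)
    simp only [List.length_cons, List.length_append, List.length_reverse, List.length_nil] at this
    omega
  · have := hmax _ _ _ (hW.earIn (((h1.cons hby).append h8 (.single s)).cons hab)
      (by
        simp only [List.nodup_cons, List.nodup_append, List.cons_append, List.mem_cons,
          List.mem_append]
        refine ⟨by simp [*], by simp [*], h2, by simp, ?_⟩
        rintro x hx w hw rfl
        simp at hw
        subst hw
        exact hQe hx)
      (by
        intro x hx
        simp at hx
        rcases hx with rfl | rfl | hx | rfl
        exacts [haW, hbW, h3 _ hx, heW]) hu hv hur hvr huv)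
    simp only [List.length_cons, List.length_append, List.length_nil] at this
    omega

/-- A longest ear, if it has fewer than four vertices, has no neighbours outside the cycle. -/
theorem isClosedOff_or_four_le [Finite V] (hW : G.IsClosedOff f W) (hG : G.TwoConnected)
    (hGc : G.ClawFree)
    (hcl : ∀ d e x, d ∉ Set.range f → e ∉ Set.range f → x ∈ Set.range f → G.Adj x d → G.Adj x e →
      d ≠ e → G.Adj d e)
    {D : List V} {u v : V} (hD : G.EarIn f W D u v)
    (hmax : ∀ L u v, G.EarIn f W L u v → L.length ≤ D.length)
    {x y : V} (hx : x ∈ D) (hxy : G.Adj x y) (hyf : y ∉ Set.range f) (hyD : y ∉ D) :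
    4 ≤ D.length := by
  have hy : y ∈ W := hW.2 x (hD.2.2.2.2 x hx) y hxy hyf
  by_contra! hlt
  match D, hx, hyD, hmax, hD, hlt with
  | [a], hx, hyD, hmax, hD, _ =>
    obtain rfl : x = a := by simpa using hx
    exact hW.not_adj_of_max_one hG hD hmax hy (by simpa using hyD) hxy
  | [a, b], hx, hyD, hmax, hD, _ =>
    simp only [List.mem_cons, List.not_mem_nil, or_false, not_or] at hx hyD
    rcases hx with rfl | rfl
    · exact hW.not_adj_of_max_two hG hGc hD hmax hy hyD.1 hyD.2 hxy
    · exact hW.not_adj_of_max_two hG hGc hD.reverse hmax hy hyD.2 hyD.1 hxy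
  | [a, b, e], hx, hyD, hmax, hD, _ =>
    simp only [List.mem_cons, List.not_mem_nil, or_false, not_or] at hx hyD
    obtain ⟨h1, h2, h3⟩ := hyD
    have ha := hW.not_adj_head_of_max_three hG hGc hcl hD hmax hy h1 h2 h3
    have he := hW.not_adj_head_of_max_three hG hGc hcl hD.reverse hmax hy h3 h2 h1
    rcases hx with rfl | rfl | rfl
    · exact ha hxy
    · exact hW.not_adj_middle_of_max_three hG hGc hD hmax hy h1 h2 h3 ha he hxy
    · exact he hxy
  | _ :: _ :: _ :: _ :: _, _, _, _, _, hlt =>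
    simp only [List.length_cons] at hlt
    omega

end IsClosedOff

end SimpleGraph

/-! ### The finite check on positions of ears around a cycle -/

namespace SimpleGraph

/-- The forward distance from `p` to `q` around a cycle of length `c`. -/
def cycGap (c p q : ℕ) : ℕ := (q + c - p) % c

/-- The splits, given by their first position and the distance of their ends, with `p` on the
left-hand side and `q` on the right-hand side. -/
def splitsAt (c p q : ℕ) : List (ℕ × ℕ) :=
  bif Nat.ble (cycGap c p q) 3 then
    bif Nat.beq (cycGap c p q) 0 then [] else
      bif Nat.beq (cycGap c q p) 1 then [(p, cycGap c p q), (q, 1)] else [(p, cycGap c p q)]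
  else bif Nat.beq (cycGap c q p) 1 then [(q, 1)] else []

/-- Some intervals from the two lists leave nonempty gaps on both sides. -/
def apart (c : ℕ) (l m : List (ℕ × ℕ)) : Bool :=
  l.any fun a => m.any fun b =>
    -- An interval whose ends are at distance `a.2` has `a.2 + 1` vertices; one more unit leaves a
    -- vertex between the intervals.
    Nat.ble (a.2 + 2) (cycGap c a.1 b.1) && Nat.ble (cycGap c a.1 b.1 + b.2 + 2) c

/-- Some intervals from the three lists are in cyclic order, with nonempty gaps between them. -/
def apart₃ (c : ℕ) (l m k : List (ℕ × ℕ)) : Bool :=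
  l.any fun a => m.any fun b => k.any fun e =>
    Nat.ble (a.2 + 2) (cycGap c a.1 b.1) &&
      Nat.ble (cycGap c a.1 b.1 + b.2 + 2) (cycGap c a.1 e.1) &&
      Nat.ble (cycGap c a.1 e.1 + e.2 + 2) c

/-- The two orientations of an ear. -/
def orientations (u : ℕ × ℕ) : List (ℕ × ℕ) := [u, (u.2, u.1)]

/-- Two ears to which `IsLongestCycle.false_of_two_splits` applies. -/
def twoSplit (c : ℕ) (u w : ℕ × ℕ) : Bool :=
  (orientations w).any fun w =>
    apart c (splitsAt c u.1 w.1) (splitsAt c u.2 w.2) ||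
      apart c (splitsAt c w.1 u.1) (splitsAt c w.2 u.2)

/-- Three ears that give a path through the whole cycle, with `w` in its middle. -/
def pathSplit (c : ℕ) (u w z : ℕ × ℕ) : Bool :=
  (orientations u).any fun u => (orientations w).any fun w => (orientations z).any fun z =>
    apart c (splitsAt c u.1 w.1) (splitsAt c z.1 w.2) ||
      apart c (splitsAt c w.1 u.1) (splitsAt c w.2 z.1)

/-- Three ears to which `IsLongestCycle.false_of_three_splits` applies. -/
def threeSplit (c : ℕ) (u w z : ℕ × ℕ) : Bool :=
  (orientations u).any fun u => (orientations w).any fun w => (orientations z).any fun z =>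
    apart₃ c (splitsAt c u.1 w.1) (splitsAt c u.2 z.1) (splitsAt c w.2 z.2)

/-- An ear may be attached to a cycle of length `c` at the positions `x < y`, which are not in the
list `l`. -/
def admissible (c : ℕ) (l : List ℕ) (x y : ℕ) : Bool :=
  -- The 4 is the gap `D.length + 3` for the shortest ear, which has one vertex.
  Nat.ble (x + 4) y && Nat.ble (y + 4) (x + c) && l.all fun t => !Nat.beq t x && !Nat.beq t y

/-- The condition `p` holds for all admissible positions `x < y` with `lo < x`. -/
def allAdmissible (c lo : ℕ) (l : List ℕ) (p : ℕ × ℕ → Bool) : Bool :=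
  (List.range c).all fun y => (List.range y).all fun x =>
    Nat.ble x lo || !admissible c l x y || p (x, y)

theorem of_allAdmissible {c lo : ℕ} {l : List ℕ} {p : ℕ × ℕ → Bool} (h : allAdmissible c lo l p = true)
    {x y : ℕ} (hlo : lo < x) (hy : y < c) (hxy : x + 4 ≤ y) (hyx : y + 4 ≤ x + c) (hx : x ∉ l) (hyl : y ∉ l) :
    p (x, y) = true := by
  simp only [allAdmissible, List.all_eq_true, List.mem_range] at h
  have := h y hy x (by omega)
  have ha : admissible c l x y = true := by
    simp only [admissible, Bool.and_eq_true, Nat.ble_eq, List.all_eq_true, Bool.not_eq_true',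
      Bool.eq_false_iff, ne_eq, Nat.beq_eq]
    exact ⟨⟨hxy, hyx⟩, fun t ht => ⟨fun e => hx (e ▸ ht), fun e => hyl (e ▸ ht)⟩⟩
  have hlo' : Nat.ble x lo = false := by
    rw [Bool.eq_false_iff, ne_eq, Nat.ble_eq]; omega
  simpa [ha, hlo'] using this

/-- Any three ears of a cycle of length `c` allow a longer cycle or a path through everything. -/
def checkThree (c : ℕ) : Bool :=
  -- By rotation the first ear is attached at 0; the remaining ears are taken in the order of their
  -- first positions, whence the lower bounds `0` and `w.1`.
  (List.range c).all fun a => !admissible c [] 0 a ||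
    allAdmissible c 0 [0, a] fun w => twoSplit c (0, a) w ||
      allAdmissible c w.1 [0, a, w.1, w.2] fun z =>
        twoSplit c (0, a) z || twoSplit c w z || pathSplit c (0, a) w z ||
        pathSplit c (0, a) z w || pathSplit c w (0, a) z

/-- Any four ears of a cycle of length `c` allow a longer cycle. -/
def checkFour (c : ℕ) : Bool :=
  (List.range c).all fun a => !admissible c [] 0 a ||
    allAdmissible c 0 [0, a] fun w => twoSplit c (0, a) w ||
      allAdmissible c w.1 [0, a, w.1, w.2] fun z => twoSplit c (0, a) z || twoSplit c w z ||
        allAdmissible c z.1 [0, a, w.1, w.2, z.1, z.2] fun t =>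
          twoSplit c (0, a) t || twoSplit c w t || twoSplit c z t ||
          ([(0, a), w, z, t].any fun u => [(0, a), w, z, t].any fun v =>
            [(0, a), w, z, t].any fun q => u != v && u != q && v != q && threeSplit c u v q)

/-- The range ends at 15 because three disjoint ears in a graph of order at most 18 leave at most 15
vertices for the cycle. -/
theorem checkThree_eq_true : (List.range 16).all checkThree = true := by
  decide +kernel

/-- Four disjoint ears leave at most 14 vertices for the cycle. Only longer cycles are sought here,
so it does not matter whether there are still more ears. -/
theorem checkFour_eq_true : (List.range 15).all checkFour = true := by
  decide +kernel

end SimpleGraph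

/-! ### Soundness of the finite check -/

namespace SimpleGraph

variable {V : Type*} {G : SimpleGraph V} {f : ℤ → V} {c : ℕ} {W : Set V}

theorem cycGap_spec {p q : ℕ} (hp : p < c) : (c : ℤ) ∣ q - (p + cycGap c p q) := by
  unfold cycGap
  have h := Nat.div_add_mod (q + c - p) c
  refine ⟨((q + c - p) / c : ℕ) - 1, ?_⟩
  have h' : (c : ℤ) * ((q + c - p) / c : ℕ) + ((q + c - p) % c : ℕ) = q + c - p := by
    rw [← Nat.cast_mul, ← Nat.cast_add, h]
    omega
  linarith

/-- By periodicity a split depends on its position only modulo `c`; this moves splits found at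
natural-number positions to integer positions in cyclic order. -/
theorem IsLongestCycle.split_congr (h : G.IsLongestCycle f c) {s s' : ℤ} {n : ℕ} {x y : V}
    (hs : G.Split f s n x y) (hss : (c : ℤ) ∣ s' - s) : G.Split f s' n x y := by
  have key : ∀ t, f (s' + t) = f (s + t) := fun t =>
    (h.eq_of_dvd (by rwa [add_sub_add_right_eq_sub])).symm
  obtain ⟨X, Y, x₀, y₀, h1, h2, h3, h4, h5⟩ := hs
  have e : seg f s' n = seg f s n := by
    unfold seg
    exact List.map_congr_left fun t _ => key t
  refine ⟨X, Y, x₀, y₀, h1, h2, ?_, ?_, by rwa [e]⟩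
  · rw [sub_eq_add_neg, key]; rwa [sub_eq_add_neg] at h3
  · rwa [key]

/-- An entry comes either from two attachments at distance at most 3 in this order
(`split_of_attached`) or from two consecutive ones in the opposite order (`split_swap_of_attached`).
-/
theorem IsLongestCycle.split_of_mem_splitsAt (h : G.IsLongestCycle f c) (hG : G.ClawFree)
    {p q : ℕ} (hp : p < c) (hq : q < c) {d e : V} (hd : d ∉ Set.range f) (he : e ∉ Set.range f)
    (hdp : G.Adj d (f p)) (heq : G.Adj e (f q)) {a : ℕ × ℕ} (ha : a ∈ splitsAt c p q) :
    a.1 < c ∧ G.Split f a.1 (a.2 + 1) (f p) (f q) := by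
  have key1 : cycGap c p q ≤ 3 → cycGap c p q ≠ 0 → p < c ∧
      G.Split f p (cycGap c p q + 1) (f p) (f q) := by
    intro h3 h0
    have e1 : f (p + cycGap c p q : ℤ) = f q := h.eq_of_dvd (cycGap_spec hp)
    have := h.split_of_attached hG hd he hdp (n := cycGap c p q) (by rwa [e1]) (by omega) h3
    rw [e1] at this
    exact ⟨hp, this⟩
  have key2 : cycGap c q p = 1 → q < c ∧ G.Split f q (1 + 1) (f p) (f q) := by
    intro h1
    have e1 : f (q + 1 : ℤ) = f p := by
      have := h.eq_of_dvd (cycGap_spec (q := p) hq)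
      rwa [h1] at this
    have := h.split_swap_of_attached hG he hd heq (by rwa [e1])
    rw [e1] at this
    exact ⟨hq, this⟩
  unfold splitsAt at ha
  cases h1 : Nat.ble (cycGap c p q) 3 <;> cases h2 : Nat.beq (cycGap c q p) 1 <;>
    cases h3 : Nat.beq (cycGap c p q) 0 <;>
    simp only [h1, h2, h3, cond_true, cond_false, List.mem_cons, List.not_mem_nil, or_false]
      at ha <;>
    simp only [Nat.ble_eq, Nat.beq_eq, Bool.eq_false_iff, ne_eq] at h1 h2 h3
  · subst ha; exact key2 h2
  · subst ha; exact key2 h2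
  · subst ha; exact key1 h1 h3
  · rcases ha with rfl | rfl
    · exact key1 h1 h3
    · exact key2 h2

/-- The ear `D` is joined to the positions `p.1` and `p.2` of the cycle. -/
def EarAt (G : SimpleGraph V) (f : ℤ → V) (c : ℕ) (D : List V) (p : ℕ × ℕ) : Prop :=
  G.Ear f D (f p.1) (f p.2) ∧ p.1 < c ∧ p.2 < c

theorem EarAt.of_mem_orientations {D : List V} {p q : ℕ × ℕ} (h : G.EarAt f c D p)
    (hq : q ∈ orientations p) : ∃ D' : List V, D'.Perm D ∧ G.EarAt f c D' q := by
  simp only [orientations, List.mem_cons, List.not_mem_nil, or_false] at hq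
  rcases hq with rfl | rfl
  · exact ⟨D, .refl _, h⟩
  · exact ⟨D.reverse, List.reverse_perm _, h.1.reverse, h.2.2, h.2.1⟩

theorem EarAt.exists_fst {D : List V} {p : ℕ × ℕ} (h : G.EarAt f c D p) :
    ∃ d, d ∉ Set.range f ∧ G.Adj d (f p.1) := by
  obtain ⟨⟨⟨a, b, h1, h2, h3⟩, -, h5⟩, -⟩ := h
  exact ⟨a, h5 a h1.head_mem, h2.symm⟩

theorem EarAt.exists_snd {D : List V} {p : ℕ × ℕ} (h : G.EarAt f c D p) :
    ∃ d, d ∉ Set.range f ∧ G.Adj d (f p.2) := by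
  obtain ⟨⟨⟨a, b, h1, h2, h3⟩, -, h5⟩, -⟩ := h
  exact ⟨b, h5 b h1.last_mem, h3⟩

namespace IsLongestCycle

/-- The arithmetic of `apart` translates into two splits separated by arcs of `m₁` and `m₂`
vertices, as the splicing lemmas require. -/
theorem exists_of_apart (h : G.IsLongestCycle f c) (hG : G.ClawFree) {p q p' q' : ℕ}
    (hp : p < c) (hq : q < c) (hp' : p' < c) (hq' : q' < c)
    (ap : ∃ d, d ∉ Set.range f ∧ G.Adj d (f p)) (aq : ∃ d, d ∉ Set.range f ∧ G.Adj d (f q))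
    (ap' : ∃ d, d ∉ Set.range f ∧ G.Adj d (f p')) (aq' : ∃ d, d ∉ Set.range f ∧ G.Adj d (f q'))
    (ha : apart c (splitsAt c p q) (splitsAt c p' q') = true) :
    ∃ (s₁ s₂ : ℤ) (n₁ m₁ n₂ m₂ : ℕ), 1 ≤ m₁ ∧ 1 ≤ m₂ ∧ n₁ + m₁ + n₂ + m₂ = c ∧
      s₂ = s₁ + n₁ + m₁ ∧ G.Split f s₁ n₁ (f p) (f q) ∧ G.Split f s₂ n₂ (f p') (f q') := by
  obtain ⟨dp, hdp, dp'⟩ := ap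
  obtain ⟨dq, hdq, dq'⟩ := aq
  obtain ⟨ep, hep, ep'⟩ := ap'
  obtain ⟨eq, heq, eq'⟩ := aq'
  simp only [apart, List.any_eq_true, Bool.and_eq_true, Nat.ble_eq] at ha
  obtain ⟨a, ha, b, hb, h1, h2⟩ := ha
  obtain ⟨ha1, ha2⟩ := h.split_of_mem_splitsAt hG hp hq hdp hdq dp' dq' ha
  obtain ⟨hb1, hb2⟩ := h.split_of_mem_splitsAt hG hp' hq' hep heq ep' eq' hb
  refine ⟨a.1, a.1 + cycGap c a.1 b.1, a.2 + 1, cycGap c a.1 b.1 - (a.2 + 1), b.2 + 1,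
    c - cycGap c a.1 b.1 - (b.2 + 1), by omega, by omega, by omega, by omega, ha2, ?_⟩
  refine h.split_congr hb2 ?_
  rw [dvd_sub_comm]
  exact cycGap_spec ha1

theorem twoSplit_eq_false (h : G.IsLongestCycle f c) (hG : G.ClawFree) {Du Dw : List V}
    {u w : ℕ × ℕ} (hu : G.EarAt f c Du u) (hw : G.EarAt f c Dw w) (hd : (Du ++ Dw).Nodup) :
    twoSplit c u w = false := by
  rw [Bool.eq_false_iff]
  intro ht
  simp only [twoSplit, List.any_eq_true, Bool.or_eq_true] at ht
  obtain ⟨w', hw', ht⟩ := ht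
  obtain ⟨D', hD', hw⟩ := hw.of_mem_orientations hw'
  have hd' : (Du ++ D').Nodup := ((hD'.append_left Du).nodup_iff).2 hd
  rcases ht with ht | ht
  · obtain ⟨s₁, s₂, n₁, m₁, n₂, m₂, h1, h2, h3, h4, h5, h6⟩ := h.exists_of_apart hG hu.2.1 hw.2.1
      hu.2.2 hw.2.2 hu.exists_fst hw.exists_fst hu.exists_snd hw.exists_snd ht
    exact h.false_of_two_splits h1 h2 h3 h4 hu.1 hw.1 hd' h5 h6
  · obtain ⟨s₁, s₂, n₁, m₁, n₂, m₂, h1, h2, h3, h4, h5, h6⟩ := h.exists_of_apart hG hw.2.1 hu.2.1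
      hw.2.2 hu.2.2 hw.exists_fst hu.exists_fst hw.exists_snd hu.exists_snd ht
    exact h.false_of_two_splits h1 h2 h3 h4 hw.1 hu.1 (List.nodup_append_comm.1 hd') h5 h6

theorem threeSplit_eq_false (h : G.IsLongestCycle f c) (hG : G.ClawFree) {Du Dw Dz : List V}
    {u w z : ℕ × ℕ} (hu : G.EarAt f c Du u) (hw : G.EarAt f c Dw w) (hz : G.EarAt f c Dz z)
    (hd : (Du ++ Dw ++ Dz).Nodup) : threeSplit c u w z = false := by
  rw [Bool.eq_false_iff]
  intro ht
  simp only [threeSplit, List.any_eq_true] at ht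
  obtain ⟨u', hu', w', hw', z', hz', ht⟩ := ht
  obtain ⟨Du', hDu, hu⟩ := hu.of_mem_orientations hu'
  obtain ⟨Dw', hDw, hw⟩ := hw.of_mem_orientations hw'
  obtain ⟨Dz', hDz, hz⟩ := hz.of_mem_orientations hz'
  have hd' : (Du' ++ Dw' ++ Dz').Nodup := (((hDu.append hDw).append hDz).nodup_iff).2 hd
  simp only [apart₃, List.any_eq_true, Bool.and_eq_true, Nat.ble_eq] at ht
  obtain ⟨a, ha, b, hb, e, he, ⟨h1, h2⟩, h3⟩ := ht
  obtain ⟨x1, x2, x3⟩ := hu.exists_fst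
  obtain ⟨y1, y2, y3⟩ := hu.exists_snd
  obtain ⟨x4, x5, x6⟩ := hw.exists_fst
  obtain ⟨y4, y5, y6⟩ := hw.exists_snd
  obtain ⟨x7, x8, x9⟩ := hz.exists_fst
  obtain ⟨y7, y8, y9⟩ := hz.exists_snd
  obtain ⟨ha1, ha2⟩ := h.split_of_mem_splitsAt hG hu.2.1 hw.2.1 x2 x5 x3 x6 ha
  obtain ⟨hb1, hb2⟩ := h.split_of_mem_splitsAt hG hu.2.2 hz.2.1 y2 x8 y3 x9 hb
  obtain ⟨he1, he2⟩ := h.split_of_mem_splitsAt hG hw.2.2 hz.2.2 y5 y8 y6 y9 he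
  refine h.false_of_three_splits (s₁ := a.1) (s₂ := a.1 + cycGap c a.1 b.1)
    (s₃ := a.1 + cycGap c a.1 e.1) (n₁ := a.2 + 1) (m₁ := cycGap c a.1 b.1 - (a.2 + 1))
    (n₂ := b.2 + 1) (m₂ := cycGap c a.1 e.1 - cycGap c a.1 b.1 - (b.2 + 1)) (n₃ := e.2 + 1)
    (m₃ := c - cycGap c a.1 e.1 - (e.2 + 1)) (by omega) (by omega) (by omega) (by omega)
    (by omega) (by omega) hu.1 hw.1 hz.1 hd' ha2 (h.split_congr hb2 ?_) (h.split_congr he2 ?_) <;>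
  · rw [dvd_sub_comm]
    exact cycGap_spec ha1

theorem traceable_of_perm (h : G.IsLongestCycle f c) {s : ℤ} {a b : V} {l D : List V}
    (hl : G.WalkList a b l) (hp : l.Perm (seg f s c ++ D)) (hD : D.Nodup)
    (hDf : ∀ x ∈ D, x ∉ Set.range f) (hV : ∀ v, v ∈ Set.range f ∨ v ∈ D) : G.Traceable := by
  refine hl.traceable (hp.nodup_iff.2 (h.nodup_append s le_rfl hD hDf)) fun v => ?_
  rw [hp.mem_iff, List.mem_append, h.mem_seg_iff]
  exact hV v

theorem traceable_of_pathSplit (h : G.IsLongestCycle f c) (hG : G.ClawFree) {Du Dw Dz : List V}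
    {u w z : ℕ × ℕ} (hu : G.EarAt f c Du u) (hw : G.EarAt f c Dw w) (hz : G.EarAt f c Dz z)
    (hd : (Du ++ Dw ++ Dz).Nodup) (hV : ∀ v, v ∈ Set.range f ∨ v ∈ Du ++ Dw ++ Dz)
    (ht : pathSplit c u w z = true) : G.Traceable := by
  simp only [pathSplit, List.any_eq_true, Bool.or_eq_true] at ht
  obtain ⟨u', hu', w', hw', z', hz', ht⟩ := ht
  obtain ⟨Du', hDu, hu⟩ := hu.of_mem_orientations hu'
  obtain ⟨Dw', hDw, hw⟩ := hw.of_mem_orientations hw'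
  obtain ⟨Dz', hDz, hz⟩ := hz.of_mem_orientations hz'
  have hP := (hDu.append hDw).append hDz
  have hDf : ∀ x ∈ Du' ++ Dw' ++ Dz', x ∉ Set.range f := by
    intro x hx
    simp only [List.mem_append] at hx
    rcases hx with (hx | hx) | hx
    · exact hu.1.2.2 x hx
    · exact hw.1.2.2 x hx
    · exact hz.1.2.2 x hx
  have key : ∀ {s : ℤ} {a b : V} {l : List V}, G.WalkList a b l →
      l.Perm (seg f s c ++ Du' ++ Dw' ++ Dz') → G.Traceable := by
    intro s a b l hl hp
    refine h.traceable_of_perm (s := s) hl (D := Du' ++ Dw' ++ Dz') (by simpa using hp)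
      (hP.nodup_iff.2 hd) hDf fun v => ?_
    rw [hP.mem_iff]
    exact hV v
  rcases ht with ht | ht
  · obtain ⟨s₁, s₂, n₁, m₁, n₂, m₂, h1, h2, h3, h4, h5, h6⟩ := h.exists_of_apart hG hu.2.1 hw.2.1
      hz.2.1 hw.2.2 hu.exists_fst hw.exists_fst hz.exists_fst hw.exists_snd ht
    obtain ⟨a, b, l, hl, hp⟩ := h.exists_walkList_of_two_splits h1 h2 h3 h4 hu.1 hw.1 hz.1 h5 h6
    exact key hl hp
  · obtain ⟨s₁, s₂, n₁, m₁, n₂, m₂, h1, h2, h3, h4, h5, h6⟩ := h.exists_of_apart hG hw.2.1 hu.2.1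
      hw.2.2 hz.2.1 hw.exists_fst hu.exists_fst hw.exists_snd hz.exists_fst ht
    obtain ⟨a, b, l, hl, hp⟩ := h.exists_walkList_of_two_splits' h1 h2 h3 h4 hu.1 hw.1 hz.1 h5 h6
    exact key hl hp

/-- Two nearby attachments of the two ears form a split, and the resulting path from one ear through
the whole cycle to the other is hamiltonian. The bound `5 ≤ c` leaves a vertex outside the interval
of `n + 1 ≤ 4` vertices. -/
theorem traceable_of_near (h : G.IsLongestCycle f c) (hG : G.ClawFree) (hc : 5 ≤ c)
    {Du Dw : List V} {u w : ℕ × ℕ} (hu : G.EarAt f c Du u) (hw : G.EarAt f c Dw w)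
    (hd : (Du ++ Dw).Nodup) (hV : ∀ v, v ∈ Set.range f ∨ v ∈ Du ++ Dw) {n : ℕ} (hn : 1 ≤ n)
    (hn3 : n ≤ 3) (hnear : f (u.1 + n) = f w.1) : G.Traceable := by
  obtain ⟨x1, x2, x3⟩ := hu.exists_fst
  obtain ⟨y1, y2, y3⟩ := hw.exists_fst
  have hs := h.split_of_attached hG (n := n) x2 y2 x3 (by rwa [hnear]) hn hn3
  rw [hnear] at hs
  obtain ⟨a, b, l, hl, hp⟩ := h.exists_walkList_of_split (m := c - (n + 1)) (by omega) (by omega)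
    hu.1 hw.1 hs
  refine h.traceable_of_perm hl (by simpa using hp) hd ?_ hV
  intro x hx
  rcases List.mem_append.1 hx with hx | hx
  · exact hu.1.2.2 x hx
  · exact hw.1.2.2 x hx

end IsLongestCycle

end SimpleGraph

/-! ### Isolated ears -/

namespace SimpleGraph

variable {V : Type*} {G : SimpleGraph V} {f : ℤ → V} {c : ℕ} {W : Set V}

/-- An ear that is a component outside the cycle, with the positions at which it is attached. -/
structure IsolatedEar (G : SimpleGraph V) (f : ℤ → V) (c : ℕ) (D : List V) (p : ℕ × ℕ) :
    Prop where
  earAt : G.EarAt f c D p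
  gap : p.1 + D.length + 3 ≤ p.2
  gap' : p.2 + D.length + 3 ≤ p.1 + c
  closed : ∀ x ∈ D, ∀ y, y ∉ D → y ∉ Set.range f → ¬ G.Adj x y

theorem IsolatedEar.length_pos {D : List V} {p : ℕ × ℕ} (h : G.IsolatedEar f c D p) :
    1 ≤ D.length :=
  h.earAt.1.length_pos

namespace IsLongestCycle

theorem exists_lt_eq (h : G.IsLongestCycle f c) {u : V} (hu : u ∈ Set.range f) :
    ∃ x : ℕ, x < c ∧ u = f x := by
  rw [← h.mem_seg_iff 0, mem_seg] at hu
  obtain ⟨t, ht, rfl⟩ := hu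
  exact ⟨t, ht, by simp⟩

theorem length_add_le [Finite V] (h : G.IsLongestCycle f c) {D : List V} (hD : D.Nodup)
    (hDf : ∀ x ∈ D, x ∉ Set.range f) : c + D.length ≤ Nat.card V := by
  cases nonempty_fintype V
  have := (h.nodup_append 0 le_rfl hD hDf).length_le_card
  simpa using this

theorem exists_isolatedEar [Finite V] (h : G.IsLongestCycle f c) (hG : G.TwoConnected)
    (hGc : G.ClawFree) (hn : Nat.card V ≤ 18) (hW : G.IsClosedOff f W) (hne : W.Nonempty) :
    ∃ D p, G.IsolatedEar f c D p ∧ ∀ x ∈ D, x ∈ W := by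
  have hb : ∀ D u v, G.EarIn f W D u v → D.length ≤ Nat.card V := by
    intro D u v hD
    cases nonempty_fintype V
    simpa using hD.1.2.1.length_le_card
  let P : ℕ → Prop := fun k => ∃ D u v, G.EarIn f W D u v ∧ D.length = k
  obtain ⟨D₀, u₀, v₀, hD₀⟩ := hW.exists_earIn hG (by simpa using (h.adj 0).ne) hne
  obtain ⟨D, u, v, hD, hmax⟩ : ∃ D u v, G.EarIn f W D u v ∧
      ∀ L u v, G.EarIn f W L u v → L.length ≤ D.length := by
    classical
    obtain ⟨D, u, v, hD, hk⟩ : P (Nat.findGreatest P (Nat.card V)) :=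
      Nat.findGreatest_spec (P := P) (hb _ _ _ hD₀) ⟨D₀, u₀, v₀, hD₀, rfl⟩
    exact ⟨D, u, v, hD, fun L u v hL => hk ▸ Nat.le_findGreatest (hb _ _ _ hL) ⟨L, u, v, hL, rfl⟩⟩
  obtain ⟨D, p, hD, h1, h2, hp, hmax⟩ : ∃ D, ∃ p : ℕ × ℕ, G.EarIn f W D (f p.1) (f p.2) ∧
      p.1 + D.length + 3 ≤ p.2 ∧ p.2 + D.length + 3 ≤ p.1 + c ∧ p.2 < c ∧
      ∀ L u v, G.EarIn f W L u v → L.length ≤ D.length := by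
    obtain ⟨x, hx, rfl⟩ := h.exists_lt_eq hD.2.1
    obtain ⟨y, hy, rfl⟩ := h.exists_lt_eq hD.2.2.1
    have key : ∀ D (x y : ℕ), x < y → y < c → G.EarIn f W D (f x) (f y) →
        x + D.length + 3 ≤ y ∧ y + D.length + 3 ≤ x + c := by
      intro D x y hxy hyc hD
      have h1 := h.gap_of_ear hGc hD.1 (by omega) (by omega)
      have hD' := hD.reverse.1
      -- The reversed ear, seen from `y` to `x + c`, gives the bound for the other arc.
      rw [← h.periodic x] at hD'
      have h2 := h.gap_of_ear hGc hD' (by omega) (by omega)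
      rw [List.length_reverse] at h2
      omega
    rcases lt_trichotomy x y with hxy | rfl | hxy
    · obtain ⟨h1, h2⟩ := key D x y hxy hy hD
      exact ⟨D, (x, y), hD, h1, h2, hy, hmax⟩
    · exact (hD.2.2.2.1 rfl).elim
    · obtain ⟨h1, h2⟩ := key _ y x hxy hx hD.reverse
      exact ⟨D.reverse, (y, x), hD.reverse, h1, h2, hx, by simpa using hmax⟩
  refine ⟨D, p, ⟨⟨hD.1, by omega, hp⟩, h1, h2, fun x hx y hyD hyf hxy => ?_⟩, hD.2.2.2.2⟩
  -- A further neighbour `y` would force at least four vertices in `D`. The two gaps then give `c ≥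
  -- 14`, and with `D` and `y` there would be at least 19 vertices.
  have h4 := hW.isClosedOff_or_four_le hG hGc
    (fun d e x => h.adj_of_common_attachment hGc) hD hmax hx hxy hyf hyD
  have := h.length_add_le (D := y :: D) (List.nodup_cons.2 ⟨hyD, hD.1.2.1⟩) (by
    intro x hx
    rcases List.mem_cons.1 hx with rfl | hx
    · exact hyf
    · exact hD.1.2.2 x hx)
  simp only [List.length_cons] at this
  omega

/-- At a common attachment, the two neighbours off the cycle would be adjacent by
`adj_of_common_attachment`, although `D` is isolated. -/
theorem ne_of_isolatedEar (h : G.IsLongestCycle f c) (hG : G.ClawFree) {D D' : List V}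
    {p q : ℕ × ℕ} (hD : G.IsolatedEar f c D p) (hD' : G.IsolatedEar f c D' q)
    (hd : ∀ x ∈ D', x ∉ D) : p.1 ≠ q.1 ∧ p.1 ≠ q.2 ∧ p.2 ≠ q.1 ∧ p.2 ≠ q.2 := by
  obtain ⟨⟨⟨a, b, h1, h2, h3⟩, -, h4⟩, -⟩ := hD.earAt
  obtain ⟨⟨⟨a', b', h1', h2', h3'⟩, -, h4'⟩, -⟩ := hD'.earAt
  have key : ∀ (i j : ℕ), ∀ x ∈ D, ∀ y ∈ D', G.Adj (f i) x → G.Adj (f j) y → i ≠ j := by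
    rintro i j x hx y hy hix hjy rfl
    exact hD.closed x hx y (hd y hy) (h4' y hy)
      (h.adj_of_common_attachment hG (h4 x hx) (h4' y hy) ⟨_, rfl⟩ hix hjy
        (fun e => hd y hy (e ▸ hx)))
  exact ⟨key _ _ a h1.head_mem a' h1'.head_mem h2 h2',
    key _ _ a h1.head_mem b' h1'.last_mem h2 h3'.symm,
    key _ _ b h1.last_mem a' h1'.head_mem h3.symm h2',
    key _ _ b h1.last_mem b' h1'.last_mem h3.symm h3'.symm⟩

theorem traceable_of_range (h : G.IsLongestCycle f c) (hV : ∀ v, v ∈ Set.range f) :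
    G.Traceable :=
  h.traceable_of_perm (s := 0) (D := [])
    (walkList_seg h.adj 0 (n := c) (by have := h.three_le; omega)) (by simp) (by simp) (by simp)
    (by simpa using hV)

theorem traceable_of_ear (h : G.IsLongestCycle f c) {D : List V} {p : ℕ × ℕ}
    (hD : G.EarAt f c D p) (hV : ∀ v, v ∈ Set.range f ∨ v ∈ D) : G.Traceable := by
  obtain ⟨⟨⟨a, b, h1, h2, h3⟩, h4, h5⟩, -⟩ := hD
  have hw := h.walkList_seg_between (p.1 + 1) (p.1 + 1) (m := c) (by have := h.three_le; omega)
    ⟨1, by ring⟩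
  rw [add_sub_cancel_right] at hw
  exact h.traceable_of_perm (hw.append h2 h1) (.refl _) h4 h5 hV

theorem range_shift (k : ℤ) : Set.range (fun i => f (i + k)) = Set.range f :=
  (Equiv.addRight k).surjective.range_comp f

/-- Rotation of the cycle, so that an ear is attached to its first position. -/
theorem isolatedEar_shift {D : List V} {p : ℕ × ℕ} (hD : G.IsolatedEar f c D p) :
    G.IsolatedEar (fun i => f (i + p.1)) c D (0, p.2 - p.1) := by
  have h1 := hD.gap
  have h2 := hD.gap'
  obtain ⟨⟨h3, h4, h5⟩, h6, h7⟩ := hD.earAt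
  refine ⟨⟨⟨?_, h4, by rwa [range_shift]⟩, by simp; omega, by simp; omega⟩, by simp; omega,
    by simp; omega, by rw [range_shift]; exact hD.closed⟩
  have : ((p.2 - p.1 : ℕ) : ℤ) + p.1 = p.2 := by omega
  simpa [this] using h3

end IsLongestCycle

end SimpleGraph

/-! ### Counting the ears: only two single vertices on a 16-cycle remain -/

namespace SimpleGraph

variable {V : Type*} {G : SimpleGraph V} {f : ℤ → V} {c : ℕ}

/-- Pairwise disjoint isolated ears of a cycle. -/
def EarFamily (G : SimpleGraph V) (f : ℤ → V) (c : ℕ) (L : List (List V × (ℕ × ℕ))) : Prop :=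
  (∀ e ∈ L, G.IsolatedEar f c e.1 e.2) ∧ L.Pairwise fun e e' => e.1.Disjoint e'.1

/-- The vertices outside the cycle and a family of ears. -/
def uncovered (f : ℤ → V) (L : List (List V × (ℕ × ℕ))) : Set V :=
  {v | v ∉ Set.range f ∧ ∀ e ∈ L, v ∉ e.1}

namespace EarFamily

variable {L : List (List V × (ℕ × ℕ))}

theorem perm {L' : List (List V × (ℕ × ℕ))} (h : G.EarFamily f c L) (hp : L.Perm L') :
    G.EarFamily f c L' :=
  ⟨fun e he => h.1 e (hp.mem_iff.2 he), (hp.pairwise_iff fun h => h.symm).1 h.2⟩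

/-- Isolated ears have no edges to the uncovered vertices, so the search for a further ear can be
repeated among those. -/
theorem isClosedOff (h : G.EarFamily f c L) : G.IsClosedOff f (uncovered f L) :=
  ⟨fun _ hx => hx.1, fun x hx _ hxy hy => ⟨hy, fun e he hye =>
    (h.1 e he).closed _ hye x (hx.2 e he) hx.1 hxy.symm⟩⟩

theorem nodup (h : G.EarFamily f c L) : (L.map Prod.fst).flatten.Nodup := by
  rw [List.nodup_flatten]
  refine ⟨?_, List.pairwise_map.2 h.2⟩
  intro l hl
  obtain ⟨e, he, rfl⟩ := List.mem_map.1 hl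
  exact (h.1 e he).earAt.1.2.1

theorem notMem_range (h : G.EarFamily f c L) :
    ∀ x ∈ (L.map Prod.fst).flatten, x ∉ Set.range f := by
  intro x hx
  obtain ⟨l, hl, hx⟩ := List.mem_flatten.1 hx
  obtain ⟨e, he, rfl⟩ := List.mem_map.1 hl
  exact (h.1 e he).earAt.1.2.2 x hx

theorem mem_of_uncovered_eq_empty (h : uncovered f L = ∅) (v : V) :
    v ∈ Set.range f ∨ v ∈ (L.map Prod.fst).flatten := by
  by_contra! hv
  have : v ∈ uncovered f L :=
    ⟨hv.1, fun e he hve => hv.2 (List.mem_flatten.2 ⟨e.1, List.mem_map.2 ⟨e, he, rfl⟩, hve⟩)⟩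
  rw [h] at this
  exact this

theorem exists_cons [Finite V] (h : G.EarFamily f c L) (hf : G.IsLongestCycle f c)
    (hG : G.TwoConnected) (hGc : G.ClawFree) (hn : Nat.card V ≤ 18)
    (hne : (uncovered f L).Nonempty) : ∃ e, G.EarFamily f c (e :: L) := by
  obtain ⟨D, p, hD, hDW⟩ := hf.exists_isolatedEar hG hGc hn h.isClosedOff hne
  refine ⟨(D, p), ?_, List.pairwise_cons.2 ⟨?_, h.2⟩⟩
  · simpa using ⟨hD, fun a b c => h.1 (a, b, c)⟩
  · exact fun e he x hx hxe => (hDW x hx).2 e he hxe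

theorem disjoint_of_ne (h : G.EarFamily f c L) {e e' : List V × (ℕ × ℕ)} (he : e ∈ L)
    (he' : e' ∈ L) (hne : e.2 ≠ e'.2) : e.1.Disjoint e'.1 := by
  have h' := h.2.imp (S := fun e e' : List V × (ℕ × ℕ) => e.2 ≠ e'.2 → e.1.Disjoint e'.1) fun h _ => h
  have : Std.Symm fun e e' : List V × (ℕ × ℕ) => e.2 ≠ e'.2 → e.1.Disjoint e'.1 :=
    ⟨fun _ _ h hne => (h hne.symm).symm⟩
  exact List.Pairwise.forall_of_forall (fun _ _ h => (h rfl).elim) h' he he' hne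

theorem twoSplit_eq_false (h : G.EarFamily f c L) (hf : G.IsLongestCycle f c)
    (hGc : G.ClawFree) {e e' : List V × (ℕ × ℕ)} (he : e ∈ L) (he' : e' ∈ L)
    (hne : e.2 ≠ e'.2) : twoSplit c e.2 e'.2 = false :=
  hf.twoSplit_eq_false hGc (h.1 e he).earAt (h.1 e' he').earAt
    (List.Nodup.append (h.1 e he).earAt.1.2.1 (h.1 e' he').earAt.1.2.1
      (h.disjoint_of_ne he he' hne))

theorem threeSplit_eq_false (h : G.EarFamily f c L) (hf : G.IsLongestCycle f c)
    (hGc : G.ClawFree) {e e' e'' : List V × (ℕ × ℕ)} (he : e ∈ L) (he' : e' ∈ L) (he'' : e'' ∈ L)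
    (h1 : e.2 ≠ e'.2) (h2 : e.2 ≠ e''.2) (h3 : e'.2 ≠ e''.2) :
    threeSplit c e.2 e'.2 e''.2 = false := by
  refine hf.threeSplit_eq_false hGc (h.1 e he).earAt (h.1 e' he').earAt (h.1 e'' he'').earAt
    (List.Nodup.append (List.Nodup.append (h.1 e he).earAt.1.2.1 (h.1 e' he').earAt.1.2.1
      (h.disjoint_of_ne he he' h1)) (h.1 e'' he'').earAt.1.2.1 ?_)
  rw [List.disjoint_append_left]
  exact ⟨h.disjoint_of_ne he he'' h2, h.disjoint_of_ne he' he'' h3⟩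

theorem ne_positions (h : G.EarFamily f c L) (hf : G.IsLongestCycle f c) (hGc : G.ClawFree) :
    L.Pairwise fun e e' => e.2.1 ≠ e'.2.1 ∧ e.2.1 ≠ e'.2.2 ∧ e.2.2 ≠ e'.2.1 ∧ e.2.2 ≠ e'.2.2 :=
  h.2.imp_of_mem fun he he' hd =>
    hf.ne_of_isolatedEar hGc (h.1 _ he) (h.1 _ he') fun _ hx hx' => hd hx' hx

theorem length_le [Finite V] (h : G.EarFamily f c L) (hf : G.IsLongestCycle f c) :
    c + (L.map fun e => e.1.length).sum ≤ Nat.card V := by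
  have := hf.length_add_le h.nodup h.notMem_range
  rw [List.length_flatten, List.map_map] at this
  exact this

end EarFamily

theorem admissible_zero {a : ℕ} (h : 4 ≤ a) (h' : a + 4 ≤ c) : admissible c [] 0 a = true := by
  simp [admissible, h, h']

/-- No pair of ears admits `twoSplit`, so the check leaves a triple admitting `threeSplit`, which is
impossible as well. -/
theorem false_of_four_ears_of_lt {D₁ : List V} {a : ℕ} {w z t : List V × (ℕ × ℕ)}
    (hf : G.IsLongestCycle f c) (hGc : G.ClawFree) (hc : c ≤ 14)
    (h : G.EarFamily f c [(D₁, (0, a)), w, z, t]) (hwz : w.2.1 < z.2.1) (hzt : z.2.1 < t.2.1) :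
    False := by
  have hp := h.ne_positions hf hGc
  simp only [List.pairwise_cons, List.mem_cons, List.not_mem_nil, or_false, forall_eq_or_imp,
    forall_eq, IsEmpty.forall_iff, implies_true, List.Pairwise.nil, and_true] at hp
  obtain ⟨⟨h12, h13, h14⟩, ⟨h23, h24⟩, h34⟩ := hp
  have e1 := h.1 (D₁, (0, a)) (by simp)
  have e2 := h.1 w (by simp)
  have e3 := h.1 z (by simp)
  have e4 := h.1 t (by simp)
  have l1 := e1.length_pos
  have l2 := e2.length_pos
  have l3 := e3.length_pos
  have l4 := e4.length_pos
  have g1 := e1.gap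
  have g2 := e2.gap
  have g3 := e3.gap
  have g4 := e4.gap
  have k1 := e1.gap'
  have k2 := e2.gap'
  have k3 := e3.gap'
  have k4 := e4.gap'
  have c1 := e1.earAt.2.2
  have c2 := e2.earAt.2.2
  have c3 := e3.earAt.2.2
  have c4 := e4.earAt.2.2
  dsimp only at *
  have n12 : ((0, a) : ℕ × ℕ) ≠ w.2 := fun e => h12.1 (by rw [← e])
  have n13 : ((0, a) : ℕ × ℕ) ≠ z.2 := fun e => h13.1 (by rw [← e])
  have n14 : ((0, a) : ℕ × ℕ) ≠ t.2 := fun e => h14.1 (by rw [← e])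
  have n23 : w.2 ≠ z.2 := fun e => h23.1 (by rw [← e])
  have n24 : w.2 ≠ t.2 := fun e => h24.1 (by rw [← e])
  have n34 : z.2 ≠ t.2 := fun e => h34.1 (by rw [← e])
  have t12 := h.twoSplit_eq_false hf hGc (e := (D₁, (0, a))) (e' := w) (by simp) (by simp) n12
  have t13 := h.twoSplit_eq_false hf hGc (e := (D₁, (0, a))) (e' := z) (by simp) (by simp) n13
  have t14 := h.twoSplit_eq_false hf hGc (e := (D₁, (0, a))) (e' := t) (by simp) (by simp) n14
  have t23 := h.twoSplit_eq_false hf hGc (e := w) (e' := z) (by simp) (by simp) n23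
  have t24 := h.twoSplit_eq_false hf hGc (e := w) (e' := t) (by simp) (by simp) n24
  have t34 := h.twoSplit_eq_false hf hGc (e := z) (e' := t) (by simp) (by simp) n34
  dsimp only at t12 t13 t14
  have H := List.all_eq_true.1 checkFour_eq_true c (List.mem_range.2 (by omega))
  unfold checkFour at H
  have H := List.all_eq_true.1 H a (List.mem_range.2 (by omega))
  rw [admissible_zero (by omega) (by omega), Bool.not_true, Bool.false_or] at H
  have H := of_allAdmissible H (x := w.2.1) (y := w.2.2) (by omega) (by omega) (by omega)
    (by omega) (by simp; omega) (by simp; omega)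
  simp only [Prod.mk.eta, t12, Bool.false_or] at H
  have H := of_allAdmissible H (x := z.2.1) (y := z.2.2) (by omega) (by omega) (by omega)
    (by omega) (by simp; omega) (by simp; omega)
  simp only [Prod.mk.eta, t13, t23, Bool.false_or] at H
  have H := of_allAdmissible H (x := t.2.1) (y := t.2.2) (by omega) (by omega) (by omega)
    (by omega) (by simp; omega) (by simp; omega)
  simp only [Prod.mk.eta, t14, t24, t34, Bool.false_or] at H
  rw [List.any_eq_true] at H
  obtain ⟨u, hu, H⟩ := H
  rw [List.any_eq_true] at H
  obtain ⟨v, hv, H⟩ := H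
  rw [List.any_eq_true] at H
  obtain ⟨q, hq, H⟩ := H
  simp only [Bool.and_eq_true, bne_iff_ne] at H
  obtain ⟨⟨⟨h1, h2⟩, h3⟩, H⟩ := H
  have key : ∀ u ∈ [(0, a), w.2, z.2, t.2], ∃ e ∈ [(D₁, (0, a)), w, z, t], e.2 = u := by
    simp
  obtain ⟨u, hu', rfl⟩ := key u hu
  obtain ⟨v, hv', rfl⟩ := key v hv
  obtain ⟨q, hq', rfl⟩ := key q hq
  rw [h.threeSplit_eq_false hf hGc hu' hv' hq' h1 h2 h3] at H
  exact Bool.false_ne_true H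

theorem false_of_four_ears {D₁ : List V} {a : ℕ} {w z t : List V × (ℕ × ℕ)}
    (hf : G.IsLongestCycle f c) (hGc : G.ClawFree) (hc : c ≤ 14)
    (h : G.EarFamily f c [(D₁, (0, a)), w, z, t]) : False := by
  have hp := h.ne_positions hf hGc
  simp only [List.pairwise_cons, List.mem_cons, List.not_mem_nil, or_false, forall_eq_or_imp,
    forall_eq, IsEmpty.forall_iff, implies_true, List.Pairwise.nil, and_true] at hp
  obtain ⟨-, ⟨⟨n23, -⟩, n24, -⟩, n34, -⟩ := hp
  -- Adjacent transpositions that keep the first ear in place; they sort the other three by first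
  -- position.
  have s1 : ∀ (x y u v : List V × (ℕ × ℕ)), [x, y, u, v].Perm [x, u, y, v] := fun x y u v =>
    (List.Perm.swap _ _ _).cons _
  have s2 : ∀ (x y u v : List V × (ℕ × ℕ)), [x, y, u, v].Perm [x, y, v, u] := fun x y u v =>
    ((List.Perm.swap _ _ _).cons _).cons _
  rcases lt_or_gt_of_ne n23 with l1 | l1 <;> rcases lt_or_gt_of_ne n24 with l2 | l2 <;>
    rcases lt_or_gt_of_ne n34 with l3 | l3
  · exact false_of_four_ears_of_lt hf hGc hc h l1 l3
  · exact false_of_four_ears_of_lt hf hGc hc (h.perm (s2 _ _ _ _)) l2 l3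
  · omega
  · exact false_of_four_ears_of_lt hf hGc hc (h.perm ((s2 _ _ _ _).trans (s1 _ _ _ _))) l2 l1
  · exact false_of_four_ears_of_lt hf hGc hc (h.perm (s1 _ _ _ _)) l1 l2
  · omega
  · exact false_of_four_ears_of_lt hf hGc hc (h.perm ((s1 _ _ _ _).trans (s2 _ _ _ _))) l3 l2
  · exact false_of_four_ears_of_lt hf hGc hc
      (h.perm (((s1 _ _ _ _).trans (s2 _ _ _ _)).trans (s1 _ _ _ _))) l3 l1

theorem traceable_of_three_ears_of_lt {D₁ : List V} {a : ℕ} {w z : List V × (ℕ × ℕ)}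
    (hf : G.IsLongestCycle f c) (hGc : G.ClawFree) (hc : c ≤ 15)
    (h : G.EarFamily f c [(D₁, (0, a)), w, z])
    (hV : uncovered f [(D₁, (0, a)), w, z] = ∅) (hwz : w.2.1 < z.2.1) : G.Traceable := by
  have hp := h.ne_positions hf hGc
  simp only [List.pairwise_cons, List.mem_cons, List.not_mem_nil, or_false, forall_eq_or_imp,
    forall_eq, IsEmpty.forall_iff, implies_true, List.Pairwise.nil, and_true] at hp
  obtain ⟨⟨h12, h13⟩, h23⟩ := hp
  have e1 := h.1 (D₁, (0, a)) (by simp)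
  have e2 := h.1 w (by simp)
  have e3 := h.1 z (by simp)
  have l1 := e1.length_pos
  have l2 := e2.length_pos
  have l3 := e3.length_pos
  have g1 := e1.gap
  have g2 := e2.gap
  have g3 := e3.gap
  have k1 := e1.gap'
  have k2 := e2.gap'
  have k3 := e3.gap'
  have c1 := e1.earAt.2.2
  have c2 := e2.earAt.2.2
  have c3 := e3.earAt.2.2
  dsimp only at *
  have n12 : ((0, a) : ℕ × ℕ) ≠ w.2 := fun e => h12.1 (by rw [← e])
  have n13 : ((0, a) : ℕ × ℕ) ≠ z.2 := fun e => h13.1 (by rw [← e])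
  have n23 : w.2 ≠ z.2 := fun e => h23.1 (by rw [← e])
  have t12 := h.twoSplit_eq_false hf hGc (e := (D₁, (0, a))) (e' := w) (by simp) (by simp) n12
  have t13 := h.twoSplit_eq_false hf hGc (e := (D₁, (0, a))) (e' := z) (by simp) (by simp) n13
  have t23 := h.twoSplit_eq_false hf hGc (e := w) (e' := z) (by simp) (by simp) n23
  dsimp only at t12 t13
  have H := List.all_eq_true.1 checkThree_eq_true c (List.mem_range.2 (by omega))
  unfold checkThree at H
  have H := List.all_eq_true.1 H a (List.mem_range.2 (by omega))
  rw [admissible_zero (by omega) (by omega), Bool.not_true, Bool.false_or] at H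
  have H := of_allAdmissible H (x := w.2.1) (y := w.2.2) (by omega) (by omega) (by omega)
    (by omega) (by simp; omega) (by simp; omega)
  simp only [Prod.mk.eta, t12, Bool.false_or] at H
  have H := of_allAdmissible H (x := z.2.1) (y := z.2.2) (by omega) (by omega) (by omega)
    (by omega) (by simp; omega) (by simp; omega)
  simp only [Prod.mk.eta, t13, t23, Bool.false_or, Bool.or_eq_true] at H
  have key : ∀ {x y u : List V × (ℕ × ℕ)}, [(D₁, (0, a)), w, z].Perm [x, y, u] →
      pathSplit c x.2 y.2 u.2 = true → G.Traceable := by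
    intro x y u hP hs
    have h' := h.perm hP
    have hnd := h'.nodup
    simp only [List.map_cons, List.map_nil, List.flatten_cons, List.flatten_nil, List.append_nil,
      ← List.append_assoc] at hnd
    refine hf.traceable_of_pathSplit hGc (h'.1 x (by simp)).earAt (h'.1 y (by simp)).earAt
      (h'.1 u (by simp)).earAt hnd (fun v => ?_) hs
    rcases EarFamily.mem_of_uncovered_eq_empty hV v with hv | hv
    · exact Or.inl hv
    · rw [((hP.map Prod.fst).flatten).mem_iff] at hv
      simpa using Or.inr hv
  rcases H with (H | H) | H
  · exact key (.refl _) H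
  · exact key ((List.Perm.swap _ _ _).cons _) H
  · exact key (List.Perm.swap _ _ _) H

theorem traceable_of_three_ears {D₁ : List V} {a : ℕ} {w z : List V × (ℕ × ℕ)}
    (hf : G.IsLongestCycle f c) (hGc : G.ClawFree) (hc : c ≤ 15)
    (h : G.EarFamily f c [(D₁, (0, a)), w, z])
    (hV : uncovered f [(D₁, (0, a)), w, z] = ∅) : G.Traceable := by
  have hp := h.ne_positions hf hGc
  simp only [List.pairwise_cons, List.mem_cons, List.not_mem_nil, or_false, forall_eq_or_imp,
    forall_eq, IsEmpty.forall_iff, implies_true, List.Pairwise.nil, and_true] at hp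
  rcases lt_or_gt_of_ne hp.2.1 with hlt | hlt
  · exact traceable_of_three_ears_of_lt hf hGc hc h hV hlt
  · have hP : [(D₁, (0, a)), w, z].Perm [(D₁, (0, a)), z, w] := (List.Perm.swap _ _ _).cons _
    refine traceable_of_three_ears_of_lt hf hGc hc (h.perm hP) ?_ hlt
    rw [← hV]
    ext v
    simp only [uncovered, Set.mem_ofPred_eq, hP.mem_iff]

/-- Letting `p` and `q` run over the orientations covers every pair consisting of one attachment
from each ear; at distance 1, 2 or 3 in either direction, `traceable_of_near` would apply. -/
theorem four_le_of_two_ears {e e' : List V × (ℕ × ℕ)} (hf : G.IsLongestCycle f c)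
    (hGc : G.ClawFree) (h : G.EarFamily f c [e, e']) (hV : uncovered f [e, e'] = ∅)
    (hG : ¬ G.Traceable) {p q : ℕ × ℕ} (hp : p ∈ orientations e.2) (hq : q ∈ orientations e'.2) :
    (p.1 + 4 ≤ q.1 ∧ q.1 + 4 ≤ p.1 + c) ∨ (q.1 + 4 ≤ p.1 ∧ p.1 + 4 ≤ q.1 + c) := by
  have g := (h.1 e (by simp)).gap
  have g' := (h.1 e (by simp)).gap'
  obtain ⟨D, hD, hpD⟩ := (h.1 e (by simp)).earAt.of_mem_orientations hp
  obtain ⟨D', hD', hqD⟩ := (h.1 e' (by simp)).earAt.of_mem_orientations hq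
  have hnd : (D ++ D').Nodup := by
    rw [(hD.append hD').nodup_iff]
    simpa using h.nodup
  have hcov : ∀ v, v ∈ Set.range f ∨ v ∈ D ++ D' := by
    intro v
    rw [(hD.append hD').mem_iff]
    simpa using EarFamily.mem_of_uncovered_eq_empty hV v
  have hne : p.1 ≠ q.1 := by
    have := h.ne_positions hf hGc
    simp only [List.pairwise_cons, List.mem_cons, List.not_mem_nil, or_false, forall_eq,
      IsEmpty.forall_iff, implies_true, List.Pairwise.nil, and_true] at this
    simp only [orientations, List.mem_cons, List.not_mem_nil, or_false] at hp hq
    rcases hp with rfl | rfl <;> rcases hq with rfl | rfl <;> simp [this]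
  have key1 : ∀ n : ℕ, 1 ≤ n → n ≤ 3 → f (p.1 + n) ≠ f q.1 := fun n h1 h3 e1 =>
    hG (hf.traceable_of_near hGc (by omega) hpD hqD hnd hcov h1 h3 e1)
  have key2 : ∀ n : ℕ, 1 ≤ n → n ≤ 3 → f (q.1 + n) ≠ f p.1 := fun n h1 h3 e1 =>
    hG (hf.traceable_of_near hGc (by omega) hqD hpD (List.nodup_append_comm.1 hnd)
      (fun v => (hcov v).imp_right (by simp [or_comm])) h1 h3 e1)
  have hp' := hpD.2.1
  have hq' := hqD.2.1
  -- As positions are below `c`, being at cyclic distance `n` is one of these four equations, two of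
  -- them wrapping around.
  have key : ∀ n, 1 ≤ n → n ≤ 3 → p.1 + n ≠ q.1 ∧ q.1 + n ≠ p.1 ∧ p.1 + n ≠ q.1 + c ∧
      q.1 + n ≠ p.1 + c := by
    intro n h1 h3
    refine ⟨fun e => key1 n h1 h3 ?_, fun e => key2 n h1 h3 ?_, fun e => key1 n h1 h3 ?_,
      fun e => key2 n h1 h3 ?_⟩
    · rw [← e]; simp
    · rw [← e]; simp
    · rw [← hf.periodic q.1]; exact congrArg f (by exact_mod_cast e)
    · rw [← hf.periodic p.1]; exact congrArg f (by exact_mod_cast e)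
  have k1 := key 1 (by omega) (by omega)
  have k2 := key 2 (by omega) (by omega)
  have k3 := key 3 (by omega) (by omega)
  omega

/-- The structure of 2-connected, claw-free, nontraceable graphs of order at most `18`. -/
theorem exists_cycle_and_two_ears [Finite V] (hG : G.TwoConnected) (hGc : G.ClawFree)
    (hGt : ¬ G.Traceable) (hn : Nat.card V ≤ 18) :
    ∃ (f : ℤ → V) (d₁ d₂ : V) (a x y : ℕ), G.IsLongestCycle f 16 ∧
      G.EarFamily f 16 [([d₁], (0, a)), ([d₂], (x, y))] ∧
      (a = 8 ∧ x = 4 ∧ y = 12 ∨ a = 4 ∧ x = 8 ∧ y = 12 ∨ a = 12 ∧ x = 4 ∧ y = 8) := by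
  obtain ⟨f₀, c, hf₀⟩ := exists_isLongestCycle hG.exists_cycleList
  have hL₀ : G.EarFamily f₀ c [] := by simp [EarFamily]
  obtain hne | hne := (uncovered f₀ []).eq_empty_or_nonempty
  · exact (hGt (hf₀.traceable_of_range fun v => by
      simpa using EarFamily.mem_of_uncovered_eq_empty hne v)).elim
  obtain ⟨e₀, he₀⟩ := hL₀.exists_cons hf₀ hG hGc hn hne
  have he₀ := he₀.1 e₀ (by simp)
  -- The cycle is rotated so that the first ear is attached at 0, as the check assumes.
  have hf := hf₀.shift e₀.2.1
  have h1 := IsLongestCycle.isolatedEar_shift he₀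
  set f : ℤ → V := fun i => f₀ (i + e₀.2.1)
  set a := e₀.2.2 - e₀.2.1
  set D₁ := e₀.1
  have hL₁ : G.EarFamily f c [(D₁, (0, a))] := by simpa [EarFamily] using h1
  obtain hne | hne := (uncovered f [(D₁, (0, a))]).eq_empty_or_nonempty
  · exact (hGt (hf.traceable_of_ear h1.earAt fun v => by
      simpa using EarFamily.mem_of_uncovered_eq_empty hne v)).elim
  obtain ⟨w, hw⟩ := hL₁.exists_cons hf hG hGc hn hne
  have hw := hw.perm (List.Perm.swap _ _ _)
  obtain hne | hne := (uncovered f [(D₁, (0, a)), w]).eq_empty_or_nonempty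
  · have hlen := hw.length_le hf
    have l1 := h1.length_pos
    have ew := hw.1 w (by simp)
    have l2 := ew.length_pos
    have g2 := ew.gap
    have g1 := h1.gap
    have k1 := h1.gap'
    have k2 := ew.gap'
    simp only [List.map_cons, List.map_nil, List.sum_cons, List.sum_nil] at hlen
    have k00 := four_le_of_two_ears hf hGc hw hne hGt (p := (0, a)) (q := w.2)
      (by simp [orientations]) (by simp [orientations])
    have k01 := four_le_of_two_ears hf hGc hw hne hGt (p := (0, a)) (q := (w.2.2, w.2.1))
      (by simp [orientations]) (by simp [orientations])
    have k10 := four_le_of_two_ears hf hGc hw hne hGt (p := (a, 0)) (q := w.2)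
      (by simp [orientations]) (by simp [orientations])
    have k11 := four_le_of_two_ears hf hGc hw hne hGt (p := (a, 0)) (q := (w.2.2, w.2.1))
      (by simp [orientations]) (by simp [orientations])
    dsimp only at *
    -- The four attachments are pairwise at cyclic distance at least 4, so `c ≥ 16`, while two
    -- nonempty ears leave at most 16 vertices for the cycle. Equality also forces single-vertex
    -- ears and equally spaced attachments.
    have hc : c = 16 := by omega
    have hl1 : D₁.length = 1 := by omega
    have hl2 : w.1.length = 1 := by omega
    obtain ⟨d₁, hd₁⟩ := List.length_eq_one_iff.1 hl1
    obtain ⟨d₂, hd₂⟩ := List.length_eq_one_iff.1 hl2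
    subst hc
    refine ⟨f, d₁, d₂, a, w.2.1, w.2.2, hf, ?_, by omega⟩
    rw [← hd₁, ← hd₂]
    exact hw
  obtain ⟨z, hz⟩ := hw.exists_cons hf hG hGc hn hne
  have hz := hz.perm ((List.Perm.swap _ _ _).trans ((List.Perm.swap _ _ _).cons _))
  have hlen := hz.length_le hf
  have l1 := h1.length_pos
  have l2 := (hz.1 w (by simp)).length_pos
  have l3 := (hz.1 z (by simp)).length_pos
  obtain hne | hne := (uncovered f [(D₁, (0, a)), w, z]).eq_empty_or_nonempty
  · simp only [List.map_cons, List.map_nil, List.sum_cons, List.sum_nil] at hlen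
    exact (hGt (traceable_of_three_ears hf hGc (by omega) hz hne)).elim
  obtain ⟨t, ht⟩ := hz.exists_cons hf hG hGc hn hne
  have ht := ht.perm ((List.Perm.swap _ _ _).trans ((List.Perm.swap _ _ _).cons _))
  have hlen := ht.length_le hf
  have l4 := (ht.1 t (by simp)).length_pos
  simp only [List.map_cons, List.map_nil, List.sum_cons, List.sum_nil] at hlen
  exact (false_of_four_ears hf hGc (by omega) ht).elim

end SimpleGraph

/-! ### A spanning copy of `graphA` or `graphB`, and the number of edges -/

namespace SimpleGraph

variable {V : Type*} {G : SimpleGraph V} {f : ℤ → V}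

/-- The cycle `f` of length `16` and two further vertices, numbered as in `cycleWithBridges`. -/
def extendCycle (f : ℤ → V) (d₁ d₂ : V) (i : Fin 18) : V :=
  if i.val < 16 then f i.val else if i.val = 16 then d₁ else d₂

theorem IsLongestCycle.injective_extendCycle (hf : G.IsLongestCycle f 16) {d₁ d₂ : V}
    (h₁ : d₁ ∉ Set.range f) (h₂ : d₂ ∉ Set.range f) (h₁₂ : d₁ ≠ d₂) :
    Function.Injective (extendCycle f d₁ d₂) := by
  intro i j hij
  unfold extendCycle at hij
  have hi := i.isLt
  have hj := j.isLt
  split_ifs at hij with a1 a2 a3 a4 a5 a6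
  · have := Int.eq_zero_of_abs_lt_dvd (hf.dvd_of_eq _ _ hij) (by rw [abs_lt]; omega)
    omega
  · exact (h₁ ⟨_, hij⟩).elim
  · exact (h₂ ⟨_, hij⟩).elim
  · exact (h₁ ⟨_, hij.symm⟩).elim
  · omega
  · exact (h₁₂ hij).elim
  · exact (h₂ ⟨_, hij.symm⟩).elim
  · exact (h₁₂ hij.symm).elim
  · omega

theorem IsLongestCycle.adj_extendCycle (hf : G.IsLongestCycle f 16) {d₁ d₂ : V}
    (hc : ∀ p ∈ [0, 4, 8, 12], G.Adj (f (p - 1)) (f (p + 1))) {l : List (Fin 18 × Fin 18)}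
    (hl : ∀ e ∈ l, G.Adj (extendCycle f d₁ d₂ e.1) (extendCycle f d₁ d₂ e.2)) {i j : Fin 18}
    (hij : (cycleWithBridges l).Adj i j) :
    G.Adj (extendCycle f d₁ d₂ i) (extendCycle f d₁ d₂ j) := by
  simp only [List.mem_cons, List.not_mem_nil, or_false, forall_eq_or_imp, forall_eq] at hc
  obtain ⟨c0, c4, c8, c12⟩ := hc
  have e15 : f (0 - 1) = f 15 := (hf.periodic (0 - 1)).symm
  rw [e15] at c0
  have key : ∀ i j : Fin 18, ((i.val < 16 ∧ j.val = (i.val + 1) % 16) ∨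
      (i, j) ∈ ([(15, 1), (3, 5), (7, 9), (11, 13)] : List (Fin 18 × Fin 18)) ∨ (i, j) ∈ l) →
      G.Adj (extendCycle f d₁ d₂ i) (extendCycle f d₁ d₂ j) := by
    rintro i j (⟨hi, hj⟩ | h | h)
    · have hj' : j.val < 16 := by omega
      have e : f (j.val : ℤ) = f (i.val + 1) :=
        hf.eq_of_dvd (by omega)
      unfold extendCycle
      rw [if_pos hi, if_pos hj', e]
      exact hf.adj _
    · simp only [List.mem_cons, List.not_mem_nil, or_false, Prod.mk.injEq] at h
      rcases h with ⟨rfl, rfl⟩ | ⟨rfl, rfl⟩ | ⟨rfl, rfl⟩ | ⟨rfl, rfl⟩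
      exacts [c0, c4, c8, c12]
    · exact hl _ h
  rw [cycleWithBridges, fromRel_adj] at hij
  rcases hij.2 with h | h
  · exact key _ _ h
  · exact (key _ _ h).symm

/-- The 2-connected, claw-free, nontraceable graphs of order at most `18` contain `graphA` or
`graphB` as a spanning subgraph. -/
theorem exists_injective_hom [Finite V] (hG : G.TwoConnected) (hGc : G.ClawFree)
    (hGt : ¬ G.Traceable) (hn : Nat.card V ≤ 18) :
    ∃ φ : Fin 18 → V, Function.Injective φ ∧
      ((∀ i j, graphA.Adj i j → G.Adj (φ i) (φ j)) ∨
        ∀ i j, graphB.Adj i j → G.Adj (φ i) (φ j)) := by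
  obtain ⟨f, d₁, d₂, a, x, y, hf, hL, hpos⟩ := exists_cycle_and_two_ears hG hGc hGt hn
  have h1 := (hL.1 _ (List.mem_cons_self ..)).earAt.1
  have h2 := (hL.1 ([d₂], (x, y)) (by simp)).earAt.1
  have hne : d₁ ≠ d₂ := by simpa using hL.nodup
  have hd₁ : d₁ ∉ Set.range f := h1.2.2 d₁ (by simp)
  have hd₂ : d₂ ∉ Set.range f := h2.2.2 d₂ (by simp)
  have hends : ∀ {d u v : V}, G.Ear f [d] u v → G.Adj d u ∧ G.Adj d v := by
    rintro d u v ⟨⟨p, q, ⟨-, hp, hq⟩, hu, hv⟩, -⟩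
    simp only [List.head?_cons, Option.some.injEq, List.getLast?_singleton] at hp hq
    subst hp hq
    exact ⟨hu.symm, hv⟩
  obtain ⟨u1, u2⟩ := hends h1
  obtain ⟨w1, w2⟩ := hends h2
  clear h1 h2 hL
  -- The cycle is left arbitrary because one of the two uncrossed pairings has to be rotated first.
  have hB : ∀ f : ℤ → V, G.IsLongestCycle f 16 → d₁ ∉ Set.range f → d₂ ∉ Set.range f →
      G.Adj d₁ (f 0) → G.Adj d₁ (f 4) → G.Adj d₂ (f 8) → G.Adj d₂ (f 12) →
      ∃ φ : Fin 18 → V, Function.Injective φ ∧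
      ((∀ i j, graphA.Adj i j → G.Adj (φ i) (φ j)) ∨
        ∀ i j, graphB.Adj i j → G.Adj (φ i) (φ j)) := by
    intro f hf hd₁ hd₂ k0 k4 k8 k12
    refine ⟨_, hf.injective_extendCycle hd₁ hd₂ hne, Or.inr fun i j => hf.adj_extendCycle ?_ ?_⟩
    · simp only [List.mem_cons, List.not_mem_nil, or_false, forall_eq_or_imp, forall_eq]
      exact ⟨hf.adj_of_attached hGc hd₁ k0, hf.adj_of_attached hGc hd₁ k4,
        hf.adj_of_attached hGc hd₂ k8, hf.adj_of_attached hGc hd₂ k12⟩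
    · simp only [List.mem_cons, List.not_mem_nil, or_false, forall_eq_or_imp, forall_eq]
      exact ⟨k0, k4, k8, k12⟩
  rcases hpos with ⟨rfl, rfl, rfl⟩ | ⟨rfl, rfl, rfl⟩ | ⟨rfl, rfl, rfl⟩ <;>
    simp only [Nat.cast_zero, Nat.cast_ofNat] at u1 u2 w1 w2
  · refine ⟨_, hf.injective_extendCycle hd₁ hd₂ hne, Or.inl fun i j => hf.adj_extendCycle ?_ ?_⟩
    · simp only [List.mem_cons, List.not_mem_nil, or_false, forall_eq_or_imp, forall_eq]
      exact ⟨hf.adj_of_attached hGc hd₁ u1, hf.adj_of_attached hGc hd₂ w1,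
        hf.adj_of_attached hGc hd₁ u2, hf.adj_of_attached hGc hd₂ w2⟩
    · simp only [List.mem_cons, List.not_mem_nil, or_false, forall_eq_or_imp, forall_eq]
      exact ⟨u1, u2, w1, w2⟩
  · exact hB f hf hd₁ hd₂ u1 u2 w1 w2
  · have e := hf.periodic
    -- The pairs `{0, 12}` and `{4, 8}` become `{0, 4}` and `{8, 12}` when position 12 is renamed 0.
    refine hB _ (hf.shift 12) (by rwa [IsLongestCycle.range_shift])
      (by rwa [IsLongestCycle.range_shift]) u2 ?_ ?_ ?_
    · have := e 0; norm_num at this ⊢; rwa [this]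
    · have := e 4; norm_num at this ⊢; rwa [this]
    · have := e 8; norm_num at this ⊢; rwa [this]

theorem Iso.ncard_edgeSet_eq {V' : Type*} {G' : SimpleGraph V'} (e : G ≃g G') :
    G.edgeSet.ncard = G'.edgeSet.ncard := by
  rw [← Nat.card_coe_set_eq, ← Nat.card_coe_set_eq]
  exact Nat.card_congr e.mapEdgeSet

/-- A graph with a spanning subgraph isomorphic to `H` has as many edges as `H` only if it is
isomorphic to `H`. -/
theorem ncard_edgeSet_of_injective_hom [Finite V] {n : ℕ} {H : SimpleGraph (Fin n)}
    {φ : Fin n → V} (hφ : Function.Injective φ) (hn : Nat.card V = n)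
    (h : ∀ i j, H.Adj i j → G.Adj (φ i) (φ j)) :
    H.edgeSet.ncard ≤ G.edgeSet.ncard ∧
      (G.edgeSet.ncard = H.edgeSet.ncard → Nonempty (G ≃g H)) := by
  cases nonempty_fintype V
  have hb : Function.Bijective φ :=
    (Fintype.bijective_iff_injective_and_card φ).2 ⟨hφ, by simpa using hn.symm⟩
  let e : Fin n ≃ V := Equiv.ofBijective φ hb
  have i : G.comap e ≃g G := Iso.comap e G
  -- Pulled back along the bijection, `G` contains `H` on the same vertices; equally many edges then
  -- make the two equal.
  have hle : H ≤ G.comap e := fun a b hab => h a b hab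
  rw [← i.ncard_edgeSet_eq]
  refine ⟨Set.ncard_le_ncard (edgeSet_mono hle) (Set.toFinite _), fun heq => ?_⟩
  have := Set.eq_of_subset_of_ncard_le (edgeSet_mono hle) heq.le (Set.toFinite _)
  rw [edgeSet_inj] at this
  rw [this]
  exact ⟨i.symm⟩

/-! ### Detour orders, and why CND graphs have no cut-vertex -/

theorem Walk.IsPath.length_succ_le_detourOrder [Finite V] {v w : V} {p : G.Walk v w}
    (hp : p.IsPath) : p.length + 1 ≤ G.detourOrder v := by
  cases nonempty_fintype V
  refine le_csSup ⟨Fintype.card V, ?_⟩ ⟨w, p, hp, rfl⟩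
  rintro n ⟨w, p, hp, rfl⟩
  exact hp.length_lt

theorem exists_isPath_length_eq_detourOrder [Finite V] (v : V) :
    ∃ (w : V) (p : G.Walk v w), p.IsPath ∧ G.detourOrder v = p.length + 1 := by
  cases nonempty_fintype V
  refine Nat.sSup_mem (s := {n : ℕ | ∃ (w : V) (p : G.Walk v w), p.IsPath ∧ n = p.length + 1})
    ⟨1, v, .nil, .nil, rfl⟩ ⟨Fintype.card V, ?_⟩
  rintro n ⟨w, p, hp, rfl⟩
  exact hp.length_lt

theorem WalkList.length_le_detourOrder [Finite V] {v w : V} {l : List V}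
    (hl : G.WalkList v w l) (hn : l.Nodup) : l.length ≤ G.detourOrder v := by
  obtain ⟨p, rfl⟩ := hl.exists_walk
  rw [Walk.length_support]
  exact (Walk.IsPath.mk' hn).length_succ_le_detourOrder

theorem WalkList.reachable_induce {a b v : V} {l : List V} (hl : G.WalkList a b l)
    (hv : ∀ x ∈ l, x ≠ v) (q : V) (hq : q ∈ l) :
    (G.induce {w : V | w ≠ v}).Reachable ⟨a, hv a hl.head_mem⟩ ⟨q, hv q hq⟩ := by
  induction l generalizing a with
  | nil => simp at hq
  | cons x l ih =>
    obtain rfl : x = a := by simpa using hl.2.1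
    rcases List.mem_cons.1 hq with rfl | hq'
    · exact .rfl
    · cases l with
      | nil => simp at hq'
      | cons y l =>
        have h1 := hl.1
        rw [List.isChain_cons_cons] at h1
        have h2 := ih (a := y) ⟨h1.2, by simp, by simpa using hl.2.2⟩
          (fun x hx => hv x (List.mem_cons_of_mem _ hx)) hq'
        refine Reachable.trans (Adj.reachable ?_) h2
        exact h1.1

theorem Connected.traceable_of_card_le_two [Finite V] (hG : G.Connected) (h : Nat.card V ≤ 2) :
    G.Traceable := by
  obtain ⟨x⟩ := hG.nonempty
  by_cases hx : ∀ y, y = x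
  · exact (WalkList.single x).traceable (by simp) (by simpa using hx)
  · push Not at hx
    obtain ⟨y, hy⟩ := hx
    have : Nontrivial V := ⟨y, x, hy⟩
    obtain ⟨z, hz⟩ := hG.preconnected.exists_adj_of_nontrivial x
    refine (WalkList.pair hz).traceable (by simpa using hz.ne) fun w => ?_
    cases nonempty_fintype V
    by_contra hw
    have hnd : [w, x, z].Nodup := by
      simp only [List.nodup_cons]
      exact ⟨hw, by simpa using hz.ne, by simp, by simp⟩
    have := hnd.length_le_card
    rw [← Nat.card_eq_fintype_card, List.length_cons, List.length_cons,
      List.length_singleton] at this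
    omega

/-- In a detour graph there is no cut-vertex. -/
theorem IsCND.twoConnected [Finite V] (hG : G.IsCND) : G.TwoConnected := by
  obtain ⟨hc, ht, hd⟩ := hG
  have h3 : 3 ≤ Nat.card V := by
    by_contra! h
    exact ht (hc.traceable_of_card_le_two (by omega))
  refine twoConnected_of_induce_connected hc h3 fun v => ?_
  have : Nontrivial V := by
    rw [← Finite.one_lt_card_iff_nontrivial]; omega
  obtain ⟨u, hu⟩ := exists_ne v
  have : Nonempty {w : V | w ≠ v} := ⟨⟨u, hu⟩⟩
  refine ⟨?_⟩
  by_contra hcon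
  have hcon' : ∃ a b : {w : V | w ≠ v}, ¬ (G.induce {w : V | w ≠ v}).Reachable a b := by
    by_contra! h
    exact hcon h
  obtain ⟨a, b, hab⟩ := hcon'
  obtain ⟨w, p, hp, hpl⟩ := exists_isPath_length_eq_detourOrder (G := G) v
  -- Every component of `G - v` contains a neighbour of `v`: a path to `v` is followed until just
  -- before it reaches `v`.
  have hnbr : ∀ a : {w : V | w ≠ v}, ∃ x : {w : V | w ≠ v}, G.Adj x.1 v ∧
      (G.induce {w : V | w ≠ v}).Reachable a x := by
    rintro ⟨a, ha⟩
    classical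
    obtain ⟨r⟩ := hc.preconnected a v
    obtain ⟨Q, z, s, h1, -, h3, -, h5, -, h7⟩ := r.bypass.exists_walkList_to_set
      r.bypass_isPath (T := {v}) (by simpa using ha) rfl
    obtain rfl : s = v := h5
    exact ⟨⟨z, h3 z h1.last_mem⟩, h7, h1.reachable_induce h3 z h1.last_mem⟩
  -- Apart from `v`, the longest path `p` lies in a single component of `G - v`, so a neighbour of
  -- `v` in another component is not on it.
  have key : ∃ x, G.Adj x v ∧ x ∉ p.support := by
    cases p with
    | nil =>
      obtain ⟨x, hx, -⟩ := hnbr a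
      exact ⟨x, hx, fun h => x.2 (List.mem_singleton.1 h)⟩
    | @cons _ h _ hvh p =>
      rw [Walk.cons_isPath_iff] at hp
      have hhv : h ≠ v := hvh.ne'
      have hne : ∀ q ∈ p.support, q ≠ v := by
        rintro q hq rfl
        exact hp.2 hq
      obtain ⟨c, hch⟩ : ∃ c : {w : V | w ≠ v},
          ¬ (G.induce {w : V | w ≠ v}).Reachable ⟨h, hhv⟩ c := by
        by_contra! hall
        exact hab ((hall a).symm.trans (hall b))
      obtain ⟨x, hx, hcx⟩ := hnbr c
      refine ⟨x, hx, fun hxp => ?_⟩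
      rcases List.mem_cons.1 hxp with hxv | hxp
      · exact x.2 hxv
      · exact hch ((p.walkList_support.reachable_induce hne x.1 hxp).trans hcx.symm)
  obtain ⟨x, hx, hxp⟩ := key
  -- Putting `x` in front of `p` makes the detour order of `x` exceed that of `v`.
  have h1 := (hp.cons (h := hx) hxp).length_succ_le_detourOrder
  rw [Walk.length_cons] at h1
  have := hd x v
  omega

end SimpleGraph

/-! ### The properties of `graphA` and `graphB` -/

namespace SimpleGraph

instance (l : List (Fin 18 × Fin 18)) : DecidableRel (cycleWithBridges l).Adj := by
  unfold cycleWithBridges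
  infer_instance

instance : DecidableRel graphA.Adj := by
  unfold graphA
  infer_instance

instance : DecidableRel graphB.Adj := by
  unfold graphB
  infer_instance

/-- The lists of neighbours of the vertices of `graphA`. -/
def neighborsA : Fin 18 → List (Fin 18) :=
  ![[1, 15, 16], [0, 2, 15], [1, 3], [2, 4, 5], [3, 5, 17], [3, 4, 6], [5, 7], [6, 8, 9],
    [7, 9, 16], [7, 8, 10], [9, 11], [10, 12, 13], [11, 13, 17], [11, 12, 14], [13, 15],
    [0, 1, 14], [0, 8], [4, 12]]

/-- The lists of neighbours of the vertices of `graphB`. -/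
def neighborsB : Fin 18 → List (Fin 18) :=
  ![[1, 15, 16], [0, 2, 15], [1, 3], [2, 4, 5], [3, 5, 16], [3, 4, 6], [5, 7], [6, 8, 9],
    [7, 9, 17], [7, 8, 10], [9, 11], [10, 12, 13], [11, 13, 17], [11, 12, 14], [13, 15],
    [0, 1, 14], [0, 4], [8, 12]]

theorem mem_neighborsA : ∀ i j, j ∈ neighborsA i ↔ graphA.Adj i j := by decide +kernel

theorem mem_neighborsB : ∀ i j, j ∈ neighborsB i ↔ graphB.Adj i j := by decide +kernel

/-- Depth-first search for a path with `k` further vertices, starting at `v` and avoiding the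
vertices in `vis`. -/
def searchPath (nb : Fin 18 → List (Fin 18)) : ℕ → List (Fin 18) → Fin 18 → Bool
  | 0, _, _ => true
  | k + 1, vis, v => (nb v).any fun y => !vis.any (fun x => Nat.beq x.val y.val) &&
      searchPath nb k (y :: vis) y

theorem searchPath_iff {G : SimpleGraph (Fin 18)} {nb : Fin 18 → List (Fin 18)}
    (hnb : ∀ i j, j ∈ nb i ↔ G.Adj i j) (k : ℕ) (vis : List (Fin 18)) (v : Fin 18) :
    searchPath nb k vis v = true ↔
      ∃ l : List (Fin 18), (v :: l).IsChain G.Adj ∧ l.Nodup ∧ (∀ x ∈ l, x ∉ vis) ∧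
        l.length = k := by
  induction k generalizing vis v with
  | zero =>
    simp only [searchPath, true_iff]
    exact ⟨[], by simp⟩
  | succ k ih =>
    have hmem : ∀ y : Fin 18, (!vis.any fun x => Nat.beq x.val y.val) = true ↔ y ∉ vis := by
      intro y
      rw [Bool.not_eq_true', Bool.eq_false_iff, not_iff_not, List.any_eq_true]
      constructor
      · rintro ⟨x, hx, hxy⟩
        rwa [← Fin.ext (Nat.eq_of_beq_eq_true hxy)]
      · exact fun hy => ⟨y, hy, by simp⟩
    simp only [searchPath, List.any_eq_true, Bool.and_eq_true, hmem, ih, hnb]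
    constructor
    · rintro ⟨y, hvy, hy, l, h1, h2, h3, h4⟩
      refine ⟨y :: l, List.isChain_cons_cons.2 ⟨hvy, h1⟩,
        List.nodup_cons.2 ⟨fun hyl => h3 y hyl (by simp), h2⟩, ?_, by simp [h4]⟩
      rintro x hx hxv
      rcases List.mem_cons.1 hx with rfl | hx
      · exact hy hxv
      · exact h3 x hx (List.mem_cons_of_mem _ hxv)
    · rintro ⟨l, h1, h2, h3, h4⟩
      cases l with
      | nil => simp at h4
      | cons y l =>
        rw [List.isChain_cons_cons] at h1
        rw [List.nodup_cons] at h2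
        refine ⟨y, h1.1, h3 y (by simp), l, h1.2, h2.2, ?_, by simpa using h4⟩
        rintro x hx hxv
        rcases List.mem_cons.1 hxv with rfl | hxv
        · exact h2.1 hx
        · exact h3 x (List.mem_cons_of_mem _ hx) hxv

/-- A hamiltonian path has 17 vertices after its first one, and the exhaustive search finds none
from any start. -/
theorem not_traceable_of_searchPath {G : SimpleGraph (Fin 18)} {nb : Fin 18 → List (Fin 18)}
    (hnb : ∀ i j, j ∈ nb i ↔ G.Adj i j) (h : ∀ v, searchPath nb 17 [v] v = false) :
    ¬ G.Traceable := by
  rintro ⟨u, v, p, hp, hall⟩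
  have hs : p.support = u :: p.support.tail := by cases p <;> rfl
  have hn := hp.support_nodup
  rw [hs, List.nodup_cons] at hn
  have hlen : p.support.length = 18 := by
    have h1 : p.support.toFinset = Finset.univ := by
      ext x; simpa using hall x
    rw [← List.toFinset_card_of_nodup hp.support_nodup, h1, Finset.card_univ, Fintype.card_fin]
  have : searchPath nb 17 [u] u = true := by
    rw [searchPath_iff hnb]
    refine ⟨p.support.tail, ?_, hn.2, ?_, by simp [hlen]⟩
    · rw [← hs]; exact p.isChain_adj_support
    · rintro x hx hxu
      rw [List.mem_singleton] at hxu
      exact hn.1 (hxu ▸ hx)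
  rw [h u] at this
  exact Bool.false_ne_true this

/-- From every vertex there is a path with `1 + 16 = 17` vertices, and one with 18 would be
hamiltonian; so every detour order is 17. -/
theorem isDetourGraph_of_searchPath {G : SimpleGraph (Fin 18)} {nb : Fin 18 → List (Fin 18)}
    (hnb : ∀ i j, j ∈ nb i ↔ G.Adj i j) (h : ∀ v, searchPath nb 16 [v] v = true)
    (hG : ¬ G.Traceable) : G.IsDetourGraph := by
  have key : ∀ v, G.detourOrder v = 17 := by
    intro v
    apply le_antisymm
    · obtain ⟨w, p, hp, hpl⟩ := exists_isPath_length_eq_detourOrder (G := G) v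
      by_contra! hlt
      refine hG ⟨v, w, p, hp, fun x => ?_⟩
      have h1 := List.toFinset_card_of_nodup hp.support_nodup
      rw [Walk.length_support] at h1
      have h2 : p.support.toFinset = Finset.univ := by
        apply Finset.eq_univ_of_card
        have := Finset.card_le_univ p.support.toFinset
        rw [Fintype.card_fin] at this ⊢
        omega
      rw [← List.mem_toFinset, h2]
      exact Finset.mem_univ x
    · obtain ⟨l, h1, h2, h3, h4⟩ := (searchPath_iff hnb _ _ _).1 (h v)
      have hw : G.WalkList v ((v :: l).getLast (by simp)) (v :: l) :=
        ⟨h1, by simp, List.getLast?_eq_some_getLast _⟩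
      have := hw.length_le_detourOrder
        (List.nodup_cons.2 ⟨fun hv => h3 v hv (by simp), h2⟩)
      simp only [List.length_cons, h4] at this
      exact this
  intro u v
  rw [key, key]

theorem not_traceable_graphA : ¬ graphA.Traceable :=
  not_traceable_of_searchPath mem_neighborsA (by decide +kernel)

theorem not_traceable_graphB : ¬ graphB.Traceable :=
  not_traceable_of_searchPath mem_neighborsB (by decide +kernel)

theorem isDetourGraph_graphA : graphA.IsDetourGraph :=
  isDetourGraph_of_searchPath mem_neighborsA (by decide +kernel) not_traceable_graphA

theorem isDetourGraph_graphB : graphB.IsDetourGraph :=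
  isDetourGraph_of_searchPath mem_neighborsB (by decide +kernel) not_traceable_graphB

/-- A walk around the 16-cycle, omitting `v`, with excursions from `x` to `16` and from `y` to
`17`. -/
def tour (v : Fin 18) (x y : ℕ) : List (Fin 18) :=
  (List.range (if v.val < 16 then 15 else 16)).flatMap fun t =>
    let z := (v.val + 1 + t) % 16
    if z = x then [Fin.ofNat 18 z, 16, Fin.ofNat 18 z]
    else if z = y then [Fin.ofNat 18 z, 17, Fin.ofNat 18 z] else [Fin.ofNat 18 z]

theorem connected_induce_of_isChain {V : Type*} {G : SimpleGraph V} {v : V} {l : List V}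
    (hl : l ≠ []) (h : l.IsChain G.Adj) (hv : v ∉ l) (hw : ∀ w, w ≠ v → w ∈ l) :
    (G.induce {w : V | w ≠ v}).Connected := by
  have hwl : G.WalkList (l.head hl) (l.getLast hl) l :=
    ⟨h, List.head?_eq_some_head hl, List.getLast?_eq_some_getLast hl⟩
  have hne : ∀ x ∈ l, x ≠ v := by
    rintro x hx rfl
    exact hv hx
  have : Nonempty {w : V | w ≠ v} := ⟨⟨l.head hl, hne _ (List.head_mem hl)⟩⟩
  refine ⟨fun a b => ?_⟩
  exact (hwl.reachable_induce hne a.1 (hw a.1 a.2)).symm.trans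
    (hwl.reachable_induce hne b.1 (hw b.1 b.2))

/-- Every vertex lies in `G - u` or in `G - v`, and both are connected and contain `w`. -/
theorem connected_of_induce {V : Type*} {G : SimpleGraph V} {u v w : V} (huv : u ≠ v)
    (hw : w ≠ u) (hwv : w ≠ v) (hu : (G.induce {x : V | x ≠ u}).Connected)
    (hv : (G.induce {x : V | x ≠ v}).Connected) : G.Connected := by
  have key : ∀ x, G.Reachable x w := by
    intro x
    by_cases hx : x = u
    · exact (hv.preconnected ⟨x, hx ▸ huv⟩ ⟨w, hwv⟩).map (Embedding.induce _).toHom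
    · exact (hu.preconnected ⟨x, hx⟩ ⟨w, hw⟩).map (Embedding.induce _).toHom
  have : Nonempty V := ⟨w⟩
  exact ⟨fun x y => (key x).trans (key y).symm⟩

theorem induce_connected_graphA (v : Fin 18) :
    (graphA.induce {w : Fin 18 | w ≠ v}).Connected := by
  -- The value 18 is never met on the 16-cycle and so suppresses an excursion, as needed for `v =
  -- 16` or `v = 17`. The other two values are the possible attachments, so one of them remains when
  -- `v` is the other.
  have h : ∀ v : Fin 18, ∃ x ∈ [0, 8, 18], ∃ y ∈ [4, 12, 18], tour v x y ≠ [] ∧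
      (tour v x y).IsChain graphA.Adj ∧ v ∉ tour v x y ∧ ∀ w, w ≠ v → w ∈ tour v x y := by
    decide +kernel
  obtain ⟨x, -, y, -, h1, h2, h3, h4⟩ := h v
  exact connected_induce_of_isChain h1 h2 h3 h4

theorem induce_connected_graphB (v : Fin 18) :
    (graphB.induce {w : Fin 18 | w ≠ v}).Connected := by
  have h : ∀ v : Fin 18, ∃ x ∈ [0, 4, 18], ∃ y ∈ [8, 12, 18], tour v x y ≠ [] ∧
      (tour v x y).IsChain graphB.Adj ∧ v ∉ tour v x y ∧ ∀ w, w ≠ v → w ∈ tour v x y := by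
    decide +kernel
  obtain ⟨x, -, y, -, h1, h2, h3, h4⟩ := h v
  exact connected_induce_of_isChain h1 h2 h3 h4

theorem connected_graphA : graphA.Connected :=
  connected_of_induce (u := 0) (v := 1) (w := 2) (by decide) (by decide) (by decide)
    (induce_connected_graphA 0) (induce_connected_graphA 1)

theorem connected_graphB : graphB.Connected :=
  connected_of_induce (u := 0) (v := 1) (w := 2) (by decide) (by decide) (by decide)
    (induce_connected_graphB 0) (induce_connected_graphB 1)

theorem twoConnected_graphA : graphA.TwoConnected :=
  twoConnected_of_induce_connected connected_graphA (by simp) induce_connected_graphA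

theorem twoConnected_graphB : graphB.TwoConnected :=
  twoConnected_of_induce_connected connected_graphB (by simp) induce_connected_graphB

theorem isCND_graphA : graphA.IsCND :=
  ⟨connected_graphA, not_traceable_graphA, isDetourGraph_graphA⟩

theorem isCND_graphB : graphB.IsCND :=
  ⟨connected_graphB, not_traceable_graphB, isDetourGraph_graphB⟩

theorem clawFree_of_forall {V : Type*} {G : SimpleGraph V}
    (h : ∀ v x y z, G.Adj v x → G.Adj v y → G.Adj v z → x ≠ y → x ≠ z → y ≠ z →
      G.Adj x y ∨ G.Adj x z ∨ G.Adj y z) : G.ClawFree := by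
  rintro ⟨e⟩
  have hadj : ∀ i : Fin 3, G.Adj (e (Sum.inl 0)) (e (Sum.inr i)) := fun i => by
    rw [e.map_adj_iff]; simp
  have hnadj : ∀ i j : Fin 3, ¬ G.Adj (e (Sum.inr i)) (e (Sum.inr j)) := fun i j => by
    rw [e.map_adj_iff]; simp
  have hne : ∀ i j : Fin 3, i ≠ j → e (Sum.inr i) ≠ e (Sum.inr j) := fun i j hij he =>
    hij (Sum.inr_injective (e.injective he))
  rcases h _ _ _ _ (hadj 0) (hadj 1) (hadj 2) (hne _ _ (by decide)) (hne _ _ (by decide))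
    (hne _ _ (by decide)) with h | h | h <;> exact hnadj _ _ h

theorem clawFree_graphA : graphA.ClawFree := by
  have h : ∀ v, ∀ x ∈ neighborsA v, ∀ y ∈ neighborsA v, ∀ z ∈ neighborsA v, x ≠ y → x ≠ z →
      y ≠ z → y ∈ neighborsA x ∨ z ∈ neighborsA x ∨ z ∈ neighborsA y := by decide +kernel
  simp only [mem_neighborsA] at h
  exact clawFree_of_forall fun v x y z hx hy hz => h v x hx y hy z hz

theorem clawFree_graphB : graphB.ClawFree := by
  have h : ∀ v, ∀ x ∈ neighborsB v, ∀ y ∈ neighborsB v, ∀ z ∈ neighborsB v, x ≠ y → x ≠ z →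
      y ≠ z → y ∈ neighborsB x ∨ z ∈ neighborsB x ∨ z ∈ neighborsB y := by decide +kernel
  simp only [mem_neighborsB] at h
  exact clawFree_of_forall fun v x y z hx hy hz => h v x hx y hy z hz

theorem ncard_edgeSet_graphA : graphA.edgeSet.ncard = 24 := by
  rw [← coe_edgeFinset, Set.ncard_coe_finset]
  have h := graphA.sum_degrees_eq_twice_card_edges
  have h' : ∑ v, graphA.degree v = 48 := by decide +kernel
  omega

theorem ncard_edgeSet_graphB : graphB.edgeSet.ncard = 24 := by
  rw [← coe_edgeFinset, Set.ncard_coe_finset]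
  have h := graphB.sum_degrees_eq_twice_card_edges
  have h' : ∑ v, graphB.degree v = 48 := by decide +kernel
  omega

/-- There is a `6`-cycle in `graphB`, but none in `graphA`. -/
theorem isEmpty_iso_graphA_graphB : IsEmpty (graphA ≃g graphB) := by
  refine ⟨fun e => ?_⟩
  -- Every closed walk of length 6 in `graphA` repeats a vertex.
  have hA : ∀ a, ∀ b ∈ neighborsA a, ∀ c ∈ neighborsA b, ∀ d ∈ neighborsA c, ∀ x ∈ neighborsA d,
      ∀ y ∈ neighborsA x, a ∈ neighborsA y → ¬ [a, b, c, d, x, y].Nodup := by decide +kernel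
  simp only [mem_neighborsA] at hA
  have hB : [(0 : Fin 18), 16, 4, 3, 2, 1, 0].IsChain graphB.Adj := by decide +kernel
  simp only [List.isChain_cons_cons, ← e.symm.map_adj_iff] at hB
  obtain ⟨h1, h2, h3, h4, h5, h6, -⟩ := hB
  exact hA _ _ h1 _ h2 _ h3 _ h4 _ h5 h6 (by simp)

instance {V E : Type*} [DecidableEq V] [DecidableEq E] (ends : E → Fin 2 → V) :
    DecidableRel (inflateInsert ends).Adj := by
  intro x y
  unfold inflateInsert
  rw [fromRel_adj]
  rcases x with x | x <;> rcases y with y | y <;> infer_instance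

/-- The vertices of the inflation of `K₄` that correspond to those of `graphA`. -/
def inflationA : Fin 18 → (Fin 6 × Fin 2) ⊕ Fin 6 :=
  ![.inl (1, 0), .inl (0, 0), .inr 0, .inl (0, 1), .inl (4, 0), .inl (3, 0), .inr 3, .inl (3, 1),
    .inl (1, 1), .inl (5, 0), .inr 5, .inl (5, 1), .inl (4, 1), .inl (2, 1), .inr 2, .inl (2, 0),
    .inr 1, .inr 4]

/-- The vertices of the inflation of `C₂ × K₂` that correspond to those of `graphB`. -/
def inflationB : Fin 18 → (Fin 6 × Fin 2) ⊕ Fin 6 :=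
  ![.inl (1, 0), .inl (0, 0), .inr 0, .inl (0, 1), .inl (1, 1), .inl (5, 0), .inr 5, .inl (5, 1),
    .inl (3, 1), .inl (2, 1), .inr 2, .inl (2, 0), .inl (3, 0), .inl (4, 1), .inr 4, .inl (4, 0),
    .inr 1, .inr 3]

theorem nonempty_iso_of_injective {V W : Type*} [Fintype V] [Fintype W] {G : SimpleGraph V}
    {H : SimpleGraph W} {φ : V → W} (hφ : Function.Injective φ)
    (hc : Fintype.card V = Fintype.card W) (h : ∀ i j, H.Adj (φ i) (φ j) ↔ G.Adj i j) :
    Nonempty (G ≃g H) :=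
  ⟨⟨Equiv.ofBijective φ ((Fintype.bijective_iff_injective_and_card φ).2 ⟨hφ, hc⟩), h _ _⟩⟩

theorem nonempty_iso_inflateInsert_graphA : Nonempty (graphA ≃g inflateInsert endsK4) :=
  nonempty_iso_of_injective (φ := inflationA) (by decide +kernel) (by simp) (by decide +kernel)

theorem nonempty_iso_inflateInsert_graphB : Nonempty (graphB ≃g inflateInsert endsC2K2) :=
  nonempty_iso_of_injective (φ := inflationB) (by decide +kernel) (by simp) (by decide +kernel)

/-- The bounds for the order and the size of 2-connected, claw-free, nontraceable graphs. -/
theorem TwoConnected.card_and_ncard_edgeSet {V : Type*} [Finite V] {G : SimpleGraph V}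
    (hG : G.TwoConnected) (hGc : G.ClawFree) (hGt : ¬ G.Traceable) :
    18 ≤ Nat.card V ∧ (Nat.card V = 18 → 24 ≤ G.edgeSet.ncard ∧
      (G.edgeSet.ncard = 24 ↔ Nonempty (G ≃g graphA) ∨ Nonempty (G ≃g graphB))) := by
  constructor
  · by_contra! hlt
    -- Even below order 18 the structure theorem would embed 18 vertices into `V`.
    obtain ⟨φ, hφ, -⟩ := exists_injective_hom hG hGc hGt (by omega)
    have := Nat.card_le_card_of_injective φ hφ
    rw [Nat.card_fin] at this
    omega
  · intro hn
    obtain ⟨φ, hφ, h⟩ := exists_injective_hom hG hGc hGt hn.le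
    have key : 24 ≤ G.edgeSet.ncard ∧
        (G.edgeSet.ncard = 24 → Nonempty (G ≃g graphA) ∨ Nonempty (G ≃g graphB)) := by
      rcases h with h | h
      · have := ncard_edgeSet_of_injective_hom hφ hn h
        rw [ncard_edgeSet_graphA] at this
        exact ⟨this.1, fun h => Or.inl (this.2 h)⟩
      · have := ncard_edgeSet_of_injective_hom hφ hn h
        rw [ncard_edgeSet_graphB] at this
        exact ⟨this.1, fun h => Or.inr (this.2 h)⟩
    refine ⟨key.1, key.2, ?_⟩
    rintro (⟨⟨e⟩⟩ | ⟨⟨e⟩⟩)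
    · rw [e.ncard_edgeSet_eq, ncard_edgeSet_graphA]
    · rw [e.ncard_edgeSet_eq, ncard_edgeSet_graphB]

end SimpleGraph

theorem mainTheorem1 :
    -- lower bounds for 2-connected, claw-free, nontraceable graphs
    (∀ (V : Type*) [Finite V] (G : SimpleGraph V),
      G.TwoConnected → G.ClawFree → ¬ G.Traceable →
        18 ≤ Nat.card V ∧
        (Nat.card V = 18 →
          24 ≤ G.edgeSet.ncard ∧
          (G.edgeSet.ncard = 24 ↔
            Nonempty (G ≃g SimpleGraph.graphA) ∨ Nonempty (G ≃g SimpleGraph.graphB)))) ∧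
    -- `A` and `B` are two such graphs, with 24 edges, and they are not isomorphic
    (SimpleGraph.graphA.TwoConnected ∧ SimpleGraph.graphA.ClawFree ∧
      ¬ SimpleGraph.graphA.Traceable ∧ SimpleGraph.graphA.edgeSet.ncard = 24) ∧
    (SimpleGraph.graphB.TwoConnected ∧ SimpleGraph.graphB.ClawFree ∧
      ¬ SimpleGraph.graphB.Traceable ∧ SimpleGraph.graphB.edgeSet.ncard = 24) ∧
    IsEmpty (SimpleGraph.graphA ≃g SimpleGraph.graphB) ∧
    -- they are the graphs obtained from `K_4` and `C_2 × K_2` by inflation and insertion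
    Nonempty (SimpleGraph.graphA ≃g SimpleGraph.inflateInsert SimpleGraph.endsK4) ∧
    Nonempty (SimpleGraph.graphB ≃g SimpleGraph.inflateInsert SimpleGraph.endsC2K2) ∧
    -- they are CND graphs, and the smallest among the claw-free CND graphs
    SimpleGraph.graphA.IsCND ∧ SimpleGraph.graphB.IsCND ∧
    (∀ (V : Type*) [Finite V] (G : SimpleGraph V),
      G.ClawFree → G.IsCND →
        18 ≤ Nat.card V ∧
        (Nat.card V = 18 →
          24 ≤ G.edgeSet.ncard ∧
          (G.edgeSet.ncard = 24 ↔
            Nonempty (G ≃g SimpleGraph.graphA) ∨ Nonempty (G ≃g SimpleGraph.graphB)))) := by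
  refine ⟨fun V _ G h1 h2 h3 => h1.card_and_ncard_edgeSet h2 h3,
    ⟨SimpleGraph.twoConnected_graphA, SimpleGraph.clawFree_graphA,
      SimpleGraph.not_traceable_graphA, SimpleGraph.ncard_edgeSet_graphA⟩,
    ⟨SimpleGraph.twoConnected_graphB, SimpleGraph.clawFree_graphB,
      SimpleGraph.not_traceable_graphB, SimpleGraph.ncard_edgeSet_graphB⟩,
    SimpleGraph.isEmpty_iso_graphA_graphB, SimpleGraph.nonempty_iso_inflateInsert_graphA,
    SimpleGraph.nonempty_iso_inflateInsert_graphB, SimpleGraph.isCND_graphA,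
    SimpleGraph.isCND_graphB,
    -- Having no cut-vertex, claw-free CND graphs fall under the 2-connected case.
    fun V _ G h1 h2 => h2.twoConnected.card_and_ncard_edgeSet h1 h2.2.1⟩
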